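/- Let $k$ be a field, $A$ an associative unital $k$-algebra, $B$ a commutative unital $k$-algebra, and $\varepsilon:B\to A$ a morphism of $k$-algebras with image in the centre of $A$. For $n\ge 0$ let $C^n=C^n((A,B,\varepsilon);A)=\mathrm{Hom}_k(A^{\otimes n}\otimes B^{\otimes n(n-1)/2},A)$, and $C^n=0$ for $n<0$. Write an elementary tensor as an upper triangular matrix $T$ with diagonal entries $a_1,\dots,a_n\in A$ and entries $b_{s,t}\in B$ for $s<t$; let $T^{i}_{i+n}$ be the submatrix on the indices $i+1,\dots,i+n$. Let $\delta_n^\varepsilon:C^n\to C^{n+1}$ be $$\delta_n^\varepsilon(f)(T)=a_1\,\varepsilon\Big(\prod_{l=2}^{n+1}b_{1,l}\Big)f(T^1_{n+1})+\sum_{i=1}^{n}(-1)^i f(M_{i,i+1})+(-1)^{n+1}f(T^0_n)\,a_{n+1}\,\varepsilon\Big(\prod_{l=1}^{n}b_{l,n+1}\Big),$$ where $M_{i,i+1}$ arises from $T$ by multiplying rows $i,i+1$ and columns $i,i+1$ entrywise, with new diagonal entry $\varepsilon(b_{i,i+1})a_ia_{i+1}$. Let $H^n((A,B,\varepsilon);A)=\ker\delta^\varepsilon_n/\mathrm{im}\,\delta^\varepsilon_{n-1}$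 be the secondary Hochschild cohomology. For $f\in C^m$, $g\in C^n$ and $0\le i\le m-1$ define $f\circ_i g\in C^{m+n-1}$ by $(f\circ_i g)(T)=f(T')$, where $T'$ is the matrix of size $m$ obtained from $T$ by replacing the indices $i+1,\dots,i+n$ by a single index, with diagonal entry $g(T^i_{i+n})$, with the entry in row $s\le i$ equal to $\prod_{i<t\le i+n}b_{s,t}$, and with the entry in the column of an index $t>i+n$ equal to $\prod_{i<s\le i+n}b_{s,t}$ (empty products are $1$); all other entries are unchanged. Put $$f\circ g=\sum_{i=0}^{m-1}(-1)^{(n-1)i}f\circ_i g,\qquad [f,g]=f\circ g-(-1)^{(m-1)(n-1)}g\circ f .$$ Then: 1. The spaces $V_m=C^{m+1}$ ($m\in\mathbb Z$) with the operations $\circ_i:V_m\otimes V_n\to V_{m+n}$, $0\le i\le m$, form a pre-Lie system: for $f\in V_m$, $g\in V_n$, $h\in V_p$ and $0\le i\le m$, $$(f\circ_i g)\circ_j h=(f\circ_j h)\circ_{i+p}g\ \text{ if } 0\le j\le i-1,\qquad (f\circ_i g)\circ_j h=f\circ_i(g\circ_{j-i}h)\ \text{ if } i\le j\le i+n .$$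 2. The bracket of two cocycles is a cocycle, and its class depends only on the classes of the two cocycles, so that $[\cdot,\cdot]$ induces bilinear maps $H^m((A,B,\varepsilon);A)\times H^n((A,B,\varepsilon);A)\to H^{m+n-1}((A,B,\varepsilon);A)$. With $H^m$ placed in degree $m-1$, this makes $H^*((A,B,\varepsilon);A)$ a graded Lie algebra over $k$: for $x,y,z$ homogeneous of degrees $|x|,|y|,|z|$, $$[x,y]=-(-1)^{|x||y|}[y,x],\qquad [x,[y,z]]=[[x,y],z]+(-1)^{|x||y|}[y,[x,z]],$$ and moreover $[x,x]=0$ if $|x|$ is even and $[x,[x,x]]=0$ if $|x|$ is odd. -/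

import Mathlib

namespace SecHoch

/-- The positions `(i, j)`, `i < j`, of the entries `b_{i,j}` of a tensor matrix of size `n`
(rows and columns are numbered from `0`). -/
abbrev Pairs (n : ℕ) : Type := {p : Fin n × Fin n // p.1 < p.2}

section Cochains

variable (k A B : Type*) [Field k] [Ring A] [Algebra k A] [CommRing B] [Algebra k B]

/-- `Hom_k (A^{⊗ n} ⊗ B^{⊗ n(n-1)/2}, A)`, written as the space of maps that are `k`-multilinear in
the diagonal entries `a_i ∈ A` and in the entries `b_{i,j} ∈ B`, `i < j`, of a tensor matrix. -/
abbrev Cochain (n : ℕ) : Type _ :=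
  MultilinearMap k (fun _ : Fin n => A) (MultilinearMap k (fun _ : Pairs n => B) A)

variable {k A B}

/-- Separate `k`-linearity in all entries of a tensor matrix. -/
structure IsMulti (k : Type*) {A B : Type*} [Field k] [Ring A] [Algebra k A] [CommRing B]
    [Algebra k B] {n : ℕ} (F : (Fin n → A) → (Pairs n → B) → A) : Prop where
  addA : ∀ a b l x y, F (Function.update a l (x + y)) b =
    F (Function.update a l x) b + F (Function.update a l y) b
  smulA : ∀ a b l (c : k) x, F (Function.update a l (c • x)) b = c • F (Function.update a l x) b
  addB : ∀ a b t x y, F a (Function.update b t (x + y)) =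
    F a (Function.update b t x) + F a (Function.update b t y)
  smulB : ∀ a b t (c : k) x, F a (Function.update b t (c • x)) = c • F a (Function.update b t x)

/-- A cochain from a function that is linear in each entry. -/
def Cochain.ofFun {n : ℕ} (F : (Fin n → A) → (Pairs n → B) → A) (hF : IsMulti k F) :
    Cochain k A B n :=
  MultilinearMap.mk' (fun a => MultilinearMap.mk' (F a) (hF.addB a) (hF.smulB a))
    (fun a l x y => MultilinearMap.ext fun b => hF.addA a b l x y)
    (fun a l c x => MultilinearMap.ext fun b => hF.smulA a b l c x)

@[simp] theorem Cochain.ofFun_apply {n : ℕ} (F : (Fin n → A) → (Pairs n → B) → A)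
    (hF : IsMulti k F) (a : Fin n → A) (b : Pairs n → B) : Cochain.ofFun F hF a b = F a b := rfl

theorem Cochain.isMulti {n : ℕ} (f : Cochain k A B n) : IsMulti k (fun a b => f a b) where
  addA a b l x y := by simp
  smulA a b l c x := by simp
  addB a b t x y := by simp
  smulB a b t c x := by simp

theorem IsMulti.add {n : ℕ} {F G : (Fin n → A) → (Pairs n → B) → A} (hF : IsMulti k F)
    (hG : IsMulti k G) : IsMulti k (fun a b => F a b + G a b) where
  addA a b l x y := by rw [hF.addA, hG.addA]; abel
  smulA a b l c x := by rw [hF.smulA, hG.smulA, smul_add]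
  addB a b t x y := by rw [hF.addB, hG.addB]; abel
  smulB a b t c x := by rw [hF.smulB, hG.smulB, smul_add]

theorem IsMulti.neg_pow {n : ℕ} {F : (Fin n → A) → (Pairs n → B) → A} (hF : IsMulti k F)
    (e : ℕ) : IsMulti k (fun a b => (-1) ^ e * F a b) where
  addA a b l x y := by rw [hF.addA, mul_add]
  smulA a b l c x := by rw [hF.smulA, mul_smul_comm]
  addB a b t x y := by rw [hF.addB, mul_add]
  smulB a b t c x := by rw [hF.smulB, mul_smul_comm]

theorem IsMulti.sum {n : ℕ} {ι : Type*} (s : Finset ι) {F : ι → (Fin n → A) → (Pairs n → B) → A}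
    (hF : ∀ i, IsMulti k (F i)) : IsMulti k (fun a b => ∑ i ∈ s, F i a b) where
  addA a b l x y := by simp only [(hF _).addA, Finset.sum_add_distrib]
  smulA a b l c x := by simp only [(hF _).smulA, Finset.smul_sum]
  addB a b t x y := by simp only [(hF _).addB, Finset.sum_add_distrib]
  smulB a b t c x := by simp only [(hF _).smulB, Finset.smul_sum]

end Cochains

section Blocks

variable {A B : Type*}

/-- The `l`-th index of the block `{i, …, i+n-1}`. -/
def blockIdx {n r : ℕ} (i : ℕ) (h : i + n ≤ r) (l : Fin n) : Fin r := ⟨i + l, by omega⟩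

/-- The diagonal `a_i, …, a_{i+n-1}` of the sub-tensor matrix on the indices `i, …, i+n-1`. -/
def blockA {n r : ℕ} (i : ℕ) (h : i + n ≤ r) (a : Fin r → A) : Fin n → A :=
  fun l => a (blockIdx i h l)

/-- The entries `b_{k,l}` of the sub-tensor matrix on the indices `i, …, i+n-1`. -/
def blockB {n r : ℕ} (i : ℕ) (h : i + n ≤ r) (b : Pairs r → B) : Pairs n → B :=
  fun q => b ⟨(blockIdx i h q.1.1, blockIdx i h q.1.2), Nat.add_lt_add_left q.2 i⟩

/-- The monotone map that sends the block `{i, …, i+n-1}` to `i` and is injective on the rest: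
`l ↦ l` for `l < i`, and `l ↦ l + 1 - n` for `l ≥ i + n`. For `n = 0` it skips the value `i`. -/
def squash (i n l : ℕ) : ℕ := if l < i then l else if l < i + n then i else l + 1 - n

/-- The diagonal of the matrix of size `m` that results from a matrix of size `r = m + n - 1` by
contracting the block `{i, …, i+n-1}` to one row and column with diagonal entry `x`. -/
def contractA {m n r : ℕ} (h : m + n = r + 1) (i : Fin m) (x : A) (a : Fin r → A) : Fin m → A :=
  fun p => if hp : p < i then a ⟨p, by omega⟩
    else if hp' : p = i then x
    else a ⟨p + n - 1, by omega⟩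

/-- The off-diagonal part of the contracted matrix: the entry at `(p, q)` is the product of all
`b_{s,t}` whose row `s` is contracted to `p` and whose column `t` is contracted to `q`. So it is a
single entry of the old matrix if `p, q ≠ i`, the product of `b_{p,t}` over the `t` of the block if
`q = i`, and the product of `b_{s,t}` over the `s` of the block if `p = i`. -/
def contractB [CommRing B] {m r : ℕ} (n : ℕ) (i : Fin m) (b : Pairs r → B) : Pairs m → B :=
  fun q => ∏ t : Pairs r with
    squash i n t.1.1 = (q.1.1 : ℕ) ∧ squash i n t.1.2 = (q.1.2 : ℕ), b t

end Blocks

section BlockLemmas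

variable {A B : Type*}

theorem blockA_update_of_mem {n r : ℕ} (i : ℕ) (h : i + n ≤ r) (a : Fin r → A) (l : Fin n) (x : A) :
    blockA i h (Function.update a (blockIdx i h l) x) = Function.update (blockA i h a) l x := by
  funext p
  by_cases hp : p = l
  · subst hp; simp [blockA]
  · have : blockIdx i h p ≠ blockIdx i h l := by
      intro e; apply hp; simp [blockIdx, Fin.ext_iff] at e ⊢; exact e
    simp [blockA, Function.update_of_ne, hp, this]

theorem blockA_update_of_notMem {n r : ℕ} (i : ℕ) (h : i + n ≤ r) (a : Fin r → A) (l : Fin r)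
    (hl : ∀ p : Fin n, blockIdx i h p ≠ l) (x : A) :
    blockA i h (Function.update a l x) = blockA i h a := by
  funext p; simp [blockA, Function.update_of_ne (hl p)]

theorem blockB_update_of_mem {n r : ℕ} (i : ℕ) (h : i + n ≤ r) (b : Pairs r → B) (q : Pairs n)
    (t : Pairs r) (h1 : t.1.1 = blockIdx i h q.1.1) (h2 : t.1.2 = blockIdx i h q.1.2) (x : B) :
    blockB i h (Function.update b t x) = Function.update (blockB i h b) q x := by
  funext p
  by_cases hp : p = q
  · subst hp
    have : t = ⟨(blockIdx i h p.1.1, blockIdx i h p.1.2), Nat.add_lt_add_left p.2 i⟩ :=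
      Subtype.ext (Prod.ext h1 h2)
    simp [blockB, this]
  · have : (⟨(blockIdx i h p.1.1, blockIdx i h p.1.2), Nat.add_lt_add_left p.2 i⟩ : Pairs r) ≠ t := by
      intro e; apply hp
      subst e
      simp [blockIdx, Fin.ext_iff] at h1 h2
      exact Subtype.ext (Prod.ext (Fin.ext h1) (Fin.ext h2))
    simp only [blockB, Function.update_of_ne hp, Function.update_of_ne this]

theorem blockB_update_of_notMem {n r : ℕ} (i : ℕ) (h : i + n ≤ r) (b : Pairs r → B) (t : Pairs r)
    (ht : ∀ q : Pairs n, t.1.1 = blockIdx i h q.1.1 → t.1.2 ≠ blockIdx i h q.1.2) (x : B) :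
    blockB i h (Function.update b t x) = blockB i h b := by
  funext p
  have : (⟨(blockIdx i h p.1.1, blockIdx i h p.1.2), Nat.add_lt_add_left p.2 i⟩ : Pairs r) ≠ t := by
    rintro rfl; exact ht p rfl rfl
  simp only [blockB, Function.update_of_ne this]

theorem contractA_eq_update {m n r : ℕ} (h : m + n = r + 1) (i : Fin m) (x y : A) (a : Fin r → A) :
    contractA h i x a = Function.update (contractA h i y a) i x := by
  funext p
  by_cases hp : p = i
  · subst hp; simp [contractA]
  · simp [contractA, hp]

/-- An index outside the block corresponds to a unique index of the contracted matrix. -/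
theorem contractA_update_of_notMem {m n r : ℕ} (h : m + n = r + 1) (i : Fin m) (l : Fin r)
    (hl : ∀ p : Fin n, blockIdx i (by omega : (i : ℕ) + n ≤ r) p ≠ l) :
    ∃ p : Fin m, ∀ (x : A) (a : Fin r → A) (y : A),
      contractA h i x (Function.update a l y) = Function.update (contractA h i x a) p y := by
  have hl' : (l : ℕ) < i ∨ (i : ℕ) + n ≤ l := by
    by_contra hc
    push Not at hc
    exact hl ⟨l - i, by omega⟩ (Fin.ext (by simp [blockIdx]; omega))
  rcases hl' with hl' | hl'
  · have hm : (l : ℕ) < m := by omega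
    refine ⟨⟨l, hm⟩, fun x a y => funext fun p => ?_⟩
    by_cases hp : (p : ℕ) = l
    · have e1 : p = ⟨l, hm⟩ := Fin.ext hp
      subst e1
      simp [contractA, Fin.lt_def, hl']
    · have e1 : p ≠ ⟨l, hm⟩ := fun e => hp (by rw [e])
      rw [Function.update_of_ne e1]
      simp only [contractA]
      split_ifs with h1 h2
      · rw [Function.update_of_ne]; intro e; exact hp (congrArg Fin.val e)
      · rfl
      · rw [Function.update_of_ne]; intro e
        have := congrArg Fin.val e
        simp only [Fin.lt_def, Fin.ext_iff] at this h1 h2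
        omega
  · have hm : (l : ℕ) + 1 - n < m := by omega
    refine ⟨⟨l + 1 - n, hm⟩, fun x a y => funext fun p => ?_⟩
    by_cases hp : (p : ℕ) = l + 1 - n
    · have e1 : p = ⟨l + 1 - n, hm⟩ := Fin.ext hp
      subst e1
      have h1 : ¬ ((⟨l + 1 - n, hm⟩ : Fin m) < i) := by rw [Fin.lt_def]; simp; omega
      have h2 : (⟨l + 1 - n, hm⟩ : Fin m) ≠ i := by rw [Ne, Fin.ext_iff]; simp; omega
      have h3 : (⟨l + 1 - n + n - 1, by omega⟩ : Fin r) = l := Fin.ext (by simp; omega)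
      simp only [contractA, h1, h2, dif_neg, not_false_eq_true, h3, Function.update_self]
    · have e1 : p ≠ ⟨l + 1 - n, hm⟩ := fun e => hp (by rw [e])
      rw [Function.update_of_ne e1]
      simp only [contractA]
      split_ifs with h1 h2
      · rw [Function.update_of_ne]; intro e
        have := congrArg Fin.val e
        simp only [Fin.lt_def] at this h1
        omega
      · rfl
      · rw [Function.update_of_ne]; intro e
        have := congrArg Fin.val e
        simp only [Fin.lt_def, Fin.ext_iff] at this h1 h2
        omega

theorem contractA_update_of_mem {m n r : ℕ} (h : m + n = r + 1) (i : Fin m) (l : Fin n) (x y : A)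
    (a : Fin r → A) :
    contractA h i x (Function.update a (blockIdx i (by omega : (i : ℕ) + n ≤ r) l) y) =
      contractA h i x a := by
  funext p
  simp only [contractA]
  split_ifs with h1 h2
  · rw [Function.update_of_ne]; intro e
    have := congrArg Fin.val e
    simp only [Fin.lt_def, blockIdx] at this h1
    omega
  · rfl
  · rw [Function.update_of_ne]; intro e
    have := congrArg Fin.val e
    simp only [Fin.lt_def, Fin.ext_iff, blockIdx] at this h1 h2
    omega

theorem prod_update_of_mem [CommRing B] {ι : Type*} [DecidableEq ι] (s : Finset ι) (b : ι → B) (t : ι)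
    (ht : t ∈ s) (y : B) :
    ∏ u ∈ s, Function.update b t y u = y * ∏ u ∈ s.erase t, b u := by
  rw [← Finset.mul_prod_erase s _ ht, Function.update_self]
  congr 1
  exact Finset.prod_congr rfl fun u hu => Function.update_of_ne (Finset.ne_of_mem_erase hu) _ _

theorem prod_update_of_notMem [CommRing B] {ι : Type*} [DecidableEq ι] (s : Finset ι) (b : ι → B) (t : ι)
    (ht : t ∉ s) (y : B) : ∏ u ∈ s, Function.update b t y u = ∏ u ∈ s, b u :=
  Finset.prod_congr rfl fun u hu => Function.update_of_ne (by rintro rfl; exact ht hu) _ _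

/-- A position whose row and column are not both in the block contributes to a unique entry of
the contracted matrix. -/
theorem contractB_update_of_notMem [CommRing B] {m n r : ℕ} (h : m + n = r + 1) (i : Fin m) (t : Pairs r)
    (ht : squash i n t.1.1 ≠ squash i n t.1.2) (b : Pairs r → B) :
    ∃ (q : Pairs m) (c : B), ∀ y : B,
      contractB n i (Function.update b t y) = Function.update (contractB n i b) q (y * c) := by
  have hlt : (t.1.1 : ℕ) < t.1.2 := t.2
  have h1 : squash i n t.1.1 < m := by unfold squash; split_ifs <;> omega
  have h2 : squash i n t.1.2 < m := by unfold squash; split_ifs <;> omega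
  have h3 : squash i n t.1.1 < squash i n t.1.2 := by
    unfold squash at ht ⊢; split_ifs at ht ⊢ <;> omega
  refine ⟨⟨(⟨_, h1⟩, ⟨_, h2⟩), h3⟩,
    ∏ u ∈ (Finset.univ.filter fun u : Pairs r =>
      squash i n u.1.1 = squash i n t.1.1 ∧ squash i n u.1.2 = squash i n t.1.2).erase t, b u,
    fun y => funext fun q => ?_⟩
  by_cases hq : q = ⟨(⟨_, h1⟩, ⟨_, h2⟩), h3⟩
  · subst hq
    rw [Function.update_self]
    exact prod_update_of_mem _ b t (by simp) y
  · rw [Function.update_of_ne hq]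
    refine prod_update_of_notMem _ b t (fun hm => hq ?_) y
    simp only [Finset.mem_filter] at hm
    exact Subtype.ext (Prod.ext (Fin.ext hm.2.1.symm) (Fin.ext hm.2.2.symm))

theorem contractB_update_of_mem [CommRing B] {m n r : ℕ} (i : Fin m) (t : Pairs r)
    (ht : squash i n t.1.1 = squash i n t.1.2) (b : Pairs r → B) (y : B) :
    contractB n i (Function.update b t y) = contractB n i b := by
  funext q
  refine prod_update_of_notMem _ b t (fun hm => ?_) y
  simp only [Finset.mem_filter] at hm
  have : (q.1.1 : ℕ) < q.1.2 := q.2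
  omega

end BlockLemmas

section Operations

variable {k A B : Type*} [Field k] [Ring A] [Algebra k A] [CommRing B] [Algebra k B]

theorem apply_contractA_add {m n r : ℕ} (h : m + n = r + 1) (i : Fin m) (f : Cochain k A B m)
    (x y : A) (a : Fin r → A) (b : Pairs m → B) : f (contractA h i (x + y) a) b =
      f (contractA h i x a) b + f (contractA h i y a) b := by
  rw [contractA_eq_update h i (x + y) 0, contractA_eq_update h i x 0, contractA_eq_update h i y 0,
    MultilinearMap.map_update_add, add_apply]

theorem apply_contractA_smul {m n r : ℕ} (h : m + n = r + 1) (i : Fin m) (f : Cochain k A B m)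
    (c : k) (x : A) (a : Fin r → A) (b : Pairs m → B) : f (contractA h i (c • x) a) b =
      c • f (contractA h i x a) b := by
  rw [contractA_eq_update h i (c • x) 0, contractA_eq_update h i x 0,
    MultilinearMap.map_update_smul, smul_apply]

theorem IsMulti.contract {m n r : ℕ} (h : m + n = r + 1) (i : Fin m) (f : Cochain k A B m)
    {G : (Fin n → A) → (Pairs n → B) → A} (hG : IsMulti k G) :
    IsMulti k (fun (a : Fin r → A) (b : Pairs r → B) =>
      f (contractA h i (G (blockA i (by omega : (i : ℕ) + n ≤ r) a) (blockB i (by omega) b)) a)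
        (contractB n i b)) := by
  have hb : (i : ℕ) + n ≤ r := by omega
  have keyA : ∀ (a : Fin r → A) (b : Pairs r → B) (l : Fin r),
      (∃ l' : Fin n, ∃ c : Fin m → A, ∀ y,
        contractA h i (G (blockA i hb (Function.update a l y)) (blockB i hb b))
          (Function.update a l y) =
        Function.update c i (G (Function.update (blockA i hb a) l' y) (blockB i hb b))) ∨
      (∃ p : Fin m, ∃ c : Fin m → A, ∀ y,
        contractA h i (G (blockA i hb (Function.update a l y)) (blockB i hb b))
          (Function.update a l y) = Function.update c p y) := by
    intro a b l
    by_cases hl : ∀ p : Fin n, blockIdx i hb p ≠ l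
    · obtain ⟨p, hp⟩ := contractA_update_of_notMem (A := A) h i l hl
      refine Or.inr ⟨p, contractA h i (G (blockA i hb a) (blockB i hb b)) a, fun y => ?_⟩
      rw [blockA_update_of_notMem i hb a l hl, hp]
    · push Not at hl
      obtain ⟨l', rfl⟩ := hl
      refine Or.inl ⟨l', contractA h i 0 a, fun y => ?_⟩
      rw [contractA_update_of_mem, blockA_update_of_mem, contractA_eq_update h i _ 0]
  have keyB : ∀ (a : Fin r → A) (b : Pairs r → B) (t : Pairs r),
      (∃ q : Pairs n, ∀ y,
        blockB i hb (Function.update b t y) = Function.update (blockB i hb b) q y ∧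
        contractB n i (Function.update b t y) = contractB n i b) ∨
      (∃ (q : Pairs m) (c : B), ∀ y,
        blockB i hb (Function.update b t y) = blockB i hb b ∧
        contractB n i (Function.update b t y) = Function.update (contractB n i b) q (y * c)) := by
    intro a b t
    have hlt : (t.1.1 : ℕ) < t.1.2 := t.2
    by_cases ht : squash i n t.1.1 = squash i n t.1.2
    · have h12 : (i : ℕ) ≤ t.1.1 ∧ (t.1.2 : ℕ) < i + n := by
        unfold squash at ht; split_ifs at ht <;> omega
      refine Or.inl ⟨⟨(⟨t.1.1 - i, by omega⟩, ⟨t.1.2 - i, by omega⟩),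
        by simp only [Fin.lt_def]; omega⟩, fun y => ⟨?_, contractB_update_of_mem i t ht b y⟩⟩
      apply blockB_update_of_mem
      · apply Fin.ext; simp [blockIdx]; omega
      · apply Fin.ext; simp [blockIdx]; omega
    · obtain ⟨q, c, hq⟩ := contractB_update_of_notMem h i t ht b
      refine Or.inr ⟨q, c, fun y => ⟨?_, hq y⟩⟩
      apply blockB_update_of_notMem
      intro p e1 e2
      apply ht
      rw [e1, e2]
      simp [squash, blockIdx]
  constructor
  · intro a b l x y
    rcases keyA a b l with ⟨l', c, hc⟩ | ⟨p, c, hc⟩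
    · simp only [hc, hG.addA, MultilinearMap.map_update_add, add_apply]
    · simp only [hc, MultilinearMap.map_update_add, add_apply]
  · intro a b l s x
    rcases keyA a b l with ⟨l', c, hc⟩ | ⟨p, c, hc⟩
    · simp only [hc, hG.smulA, MultilinearMap.map_update_smul, smul_apply]
    · simp only [hc, MultilinearMap.map_update_smul, smul_apply]
  · intro a b t x y
    rcases keyB a b t with ⟨q, hq⟩ | ⟨q, c, hq⟩
    · simp only [fun y => (hq y).1, fun y => (hq y).2, hG.addB]
      simp only [apply_contractA_add]
    · simp only [fun y => (hq y).1, fun y => (hq y).2, add_mul, MultilinearMap.map_update_add]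
  · intro a b t s x
    rcases keyB a b t with ⟨q, hq⟩ | ⟨q, c, hq⟩
    · simp only [fun y => (hq y).1, fun y => (hq y).2, hG.smulB]
      simp only [apply_contractA_smul]
    · simp only [fun y => (hq y).1, fun y => (hq y).2, smul_mul_assoc,
        MultilinearMap.map_update_smul]

/-- `f ∘_i g` for `f ∈ C^m`, `g ∈ C^n`, `0 ≤ i ≤ m - 1`, an element of `C^r`, `r = m + n - 1`:
the block on the indices `i, …, i+n-1` is contracted and its diagonal entry becomes the value of
`g` on that block; then `f` is applied. -/
def compAt {m n r : ℕ} (h : m + n = r + 1) (i : Fin m) :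
    Cochain k A B m →ₗ[k] Cochain k A B n →ₗ[k] Cochain k A B r :=
  LinearMap.mk₂ k
    (fun f g => Cochain.ofFun
      (fun a b =>
        f (contractA h i (g (blockA i (by omega : (i : ℕ) + n ≤ r) a) (blockB i (by omega) b)) a)
          (contractB n i b))
      (IsMulti.contract h i f g.isMulti))
    (fun f f' g => by ext a b; simp)
    (fun c f g => by ext a b; simp)
    (fun f g g' => by
      ext a b
      simp only [Cochain.ofFun_apply, add_apply]
      simp only [apply_contractA_add])
    (fun c f g => by
      ext a b
      simp only [Cochain.ofFun_apply, smul_apply]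
      simp only [apply_contractA_smul])

end Operations

section Differential

variable {k A B : Type*} [Field k] [Ring A] [Algebra k A] [CommRing B] [Algebra k B]

theorem prod_update_inj {ι κ : Type*} [DecidableEq ι] [Fintype κ] [DecidableEq κ] (e : κ → ι)
    (he : Function.Injective e) (b : ι → B) (l : κ) (y : B) :
    ∏ u, Function.update b (e l) y (e u) = y * ∏ u ∈ Finset.univ.erase l, b (e u) := by
  have : ∀ u, Function.update b (e l) y (e u) = Function.update (fun u => b (e u)) l y u := by
    intro u
    by_cases hu : u = l
    · subst hu; simp
    · rw [Function.update_of_ne hu, Function.update_of_ne (he.ne hu)]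
  simp only [this]
  exact prod_update_of_mem _ _ l (Finset.mem_univ l) y

/-- The positions `(0, 1), …, (0, n)` in a matrix of size `r = n + 1`. -/
def firstRow {n r : ℕ} (h : n + 1 = r) (l : Fin n) : Pairs r :=
  ⟨(⟨0, by omega⟩, ⟨l + 1, by omega⟩), by simp only [Fin.lt_def]; omega⟩

/-- The positions `(0, n), …, (n - 1, n)` in a matrix of size `r = n + 1`. -/
def lastCol {n r : ℕ} (h : n + 1 = r) (l : Fin n) : Pairs r :=
  ⟨(⟨l, by omega⟩, ⟨n, by omega⟩), by simp only [Fin.lt_def]; omega⟩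

theorem firstRow_injective {n r : ℕ} (h : n + 1 = r) : Function.Injective (firstRow h) := by
  intro x y e
  have := congrArg (fun p : Pairs r => (p.1.2 : ℕ)) e
  simp only [firstRow] at this
  exact Fin.ext (by omega)

theorem lastCol_injective {n r : ℕ} (h : n + 1 = r) : Function.Injective (lastCol h) := by
  intro x y e
  have := congrArg (fun p : Pairs r => (p.1.1 : ℕ)) e
  simp only [lastCol] at this
  exact Fin.ext this

theorem isMulti_first {n r : ℕ} (ε : B →ₐ[k] A) (h : n + 1 = r) (f : Cochain k A B n) :
    IsMulti k (fun (a : Fin r → A) (b : Pairs r → B) =>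
      a ⟨0, by omega⟩ * ε (∏ l : Fin n, b (firstRow h l)) *
        f (blockA 1 (by omega : 1 + n ≤ r) a) (blockB 1 (by omega) b)) := by
  have h1 : 1 + n ≤ r := by omega
  have keyA : ∀ l : Fin r, (l = ⟨0, by omega⟩ ∧ ∀ p : Fin n, blockIdx 1 h1 p ≠ l) ∨
      (∃ l' : Fin n, l = blockIdx 1 h1 l' ∧ (⟨0, by omega⟩ : Fin r) ≠ l) := by
    intro l
    by_cases hl : (l : ℕ) = 0
    · refine Or.inl ⟨Fin.ext hl, fun p e => ?_⟩
      have := congrArg Fin.val e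
      simp only [blockIdx] at this; omega
    · refine Or.inr ⟨⟨l - 1, by omega⟩, Fin.ext (by simp only [blockIdx]; omega), fun e => hl ?_⟩
      exact (congrArg Fin.val e).symm
  have keyB : ∀ (b : Pairs r → B) (t : Pairs r),
      (∃ c : B, ∀ y, ∏ l : Fin n, Function.update b t y (firstRow h l) = y * c ∧
        blockB 1 h1 (Function.update b t y) = blockB 1 h1 b) ∨
      (∃ q : Pairs n, ∀ y, ∏ l : Fin n, Function.update b t y (firstRow h l) =
        ∏ l : Fin n, b (firstRow h l) ∧
        blockB 1 h1 (Function.update b t y) = Function.update (blockB 1 h1 b) q y) := by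
    intro b t
    have hlt : (t.1.1 : ℕ) < t.1.2 := t.2
    by_cases ht : (t.1.1 : ℕ) = 0
    · have e : t = firstRow h ⟨t.1.2 - 1, by omega⟩ :=
        Subtype.ext (Prod.ext (Fin.ext ht) (Fin.ext (by simp only [firstRow]; omega)))
      refine Or.inl ⟨∏ u ∈ Finset.univ.erase ⟨t.1.2 - 1, by omega⟩, b (firstRow h u), fun y => ⟨?_, ?_⟩⟩
      · conv_lhs => rw [e]
        exact prod_update_inj _ (firstRow_injective h) b _ y
      · apply blockB_update_of_notMem
        intro q e1
        rw [e1] at ht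
        simp [blockIdx] at ht
    · refine Or.inr ⟨⟨(⟨t.1.1 - 1, by omega⟩, ⟨t.1.2 - 1, by omega⟩),
        by simp only [Fin.lt_def]; omega⟩, fun y => ⟨?_, ?_⟩⟩
      · refine Finset.prod_congr rfl fun l _ => Function.update_of_ne (fun e => ht ?_) _ _
        rw [← e]; rfl
      · apply blockB_update_of_mem
        · apply Fin.ext; simp only [blockIdx]; omega
        · apply Fin.ext; simp only [blockIdx]; omega
  constructor
  · intro a b l x y
    rcases keyA l with ⟨rfl, hl⟩ | ⟨l', rfl, hl⟩
    · simp only [blockA_update_of_notMem _ _ _ _ hl, Function.update_self, add_mul]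
    · simp only [blockA_update_of_mem, Function.update_of_ne hl, MultilinearMap.map_update_add,
        add_apply, mul_add]
  · intro a b l c x
    rcases keyA l with ⟨rfl, hl⟩ | ⟨l', rfl, hl⟩
    · simp only [blockA_update_of_notMem _ _ _ _ hl, Function.update_self, smul_mul_assoc]
    · simp only [blockA_update_of_mem, Function.update_of_ne hl, MultilinearMap.map_update_smul,
        smul_apply, mul_smul_comm]
  · intro a b t x y
    rcases keyB b t with ⟨c, hc⟩ | ⟨q, hq⟩
    · simp only [fun y => (hc y).1, fun y => (hc y).2, add_mul, mul_add, map_add]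
    · simp only [fun y => (hq y).1, fun y => (hq y).2, MultilinearMap.map_update_add, mul_add]
  · intro a b t s x
    rcases keyB b t with ⟨c, hc⟩ | ⟨q, hq⟩
    · simp only [fun y => (hc y).1, fun y => (hc y).2, smul_mul_assoc, mul_smul_comm, map_smul]
    · simp only [fun y => (hq y).1, fun y => (hq y).2, MultilinearMap.map_update_smul,
        mul_smul_comm]

theorem isMulti_last {n r : ℕ} (ε : B →ₐ[k] A) (h : n + 1 = r) (f : Cochain k A B n) :
    IsMulti k (fun (a : Fin r → A) (b : Pairs r → B) =>
      f (blockA 0 (by omega : 0 + n ≤ r) a) (blockB 0 (by omega) b) *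
        a ⟨n, by omega⟩ * ε (∏ l : Fin n, b (lastCol h l))) := by
  have h1 : 0 + n ≤ r := by omega
  have keyA : ∀ l : Fin r, (l = ⟨n, by omega⟩ ∧ ∀ p : Fin n, blockIdx 0 h1 p ≠ l) ∨
      (∃ l' : Fin n, l = blockIdx 0 h1 l' ∧ (⟨n, by omega⟩ : Fin r) ≠ l) := by
    intro l
    by_cases hl : (l : ℕ) = n
    · refine Or.inl ⟨Fin.ext hl, fun p e => ?_⟩
      have := congrArg Fin.val e
      simp only [blockIdx] at this; omega
    · refine Or.inr ⟨⟨l, by omega⟩, Fin.ext (by simp only [blockIdx]; omega), fun e => hl ?_⟩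
      exact (congrArg Fin.val e).symm
  have keyB : ∀ (b : Pairs r → B) (t : Pairs r),
      (∃ c : B, ∀ y, ∏ l : Fin n, Function.update b t y (lastCol h l) = y * c ∧
        blockB 0 h1 (Function.update b t y) = blockB 0 h1 b) ∨
      (∃ q : Pairs n, ∀ y, ∏ l : Fin n, Function.update b t y (lastCol h l) =
        ∏ l : Fin n, b (lastCol h l) ∧
        blockB 0 h1 (Function.update b t y) = Function.update (blockB 0 h1 b) q y) := by
    intro b t
    have hlt : (t.1.1 : ℕ) < t.1.2 := t.2
    by_cases ht : (t.1.2 : ℕ) = n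
    · have e : t = lastCol h ⟨t.1.1, by omega⟩ :=
        Subtype.ext (Prod.ext rfl (Fin.ext ht))
      refine Or.inl ⟨∏ u ∈ Finset.univ.erase ⟨t.1.1, by omega⟩, b (lastCol h u), fun y => ⟨?_, ?_⟩⟩
      · conv_lhs => rw [e]
        exact prod_update_inj _ (lastCol_injective h) b _ y
      · apply blockB_update_of_notMem
        intro q _ e1
        rw [e1] at ht
        simp only [blockIdx] at ht
        omega
    · refine Or.inr ⟨⟨(⟨t.1.1, by omega⟩, ⟨t.1.2, by omega⟩), t.2⟩, fun y => ⟨?_, ?_⟩⟩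
      · refine Finset.prod_congr rfl fun l _ => Function.update_of_ne (fun e => ht ?_) _ _
        rw [← e]; rfl
      · apply blockB_update_of_mem
        · apply Fin.ext; simp only [blockIdx]; omega
        · apply Fin.ext; simp only [blockIdx]; omega
  constructor
  · intro a b l x y
    rcases keyA l with ⟨rfl, hl⟩ | ⟨l', rfl, hl⟩
    · simp only [blockA_update_of_notMem _ _ _ _ hl, Function.update_self, add_mul, mul_add]
    · simp only [blockA_update_of_mem, Function.update_of_ne hl, MultilinearMap.map_update_add,
        add_apply, add_mul]
  · intro a b l c x
    rcases keyA l with ⟨rfl, hl⟩ | ⟨l', rfl, hl⟩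
    · simp only [blockA_update_of_notMem _ _ _ _ hl, Function.update_self, smul_mul_assoc,
        mul_smul_comm]
    · simp only [blockA_update_of_mem, Function.update_of_ne hl, MultilinearMap.map_update_smul,
        smul_apply, smul_mul_assoc]
  · intro a b t x y
    rcases keyB b t with ⟨c, hc⟩ | ⟨q, hq⟩
    · simp only [fun y => (hc y).1, fun y => (hc y).2, add_mul, mul_add, map_add]
    · simp only [fun y => (hq y).1, fun y => (hq y).2, MultilinearMap.map_update_add, add_mul]
  · intro a b t s x
    rcases keyB b t with ⟨c, hc⟩ | ⟨q, hq⟩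
    · simp only [fun y => (hc y).1, fun y => (hc y).2, smul_mul_assoc, mul_smul_comm, map_smul]
    · simp only [fun y => (hq y).1, fun y => (hq y).2, MultilinearMap.map_update_smul,
        smul_mul_assoc]

/-- The diagonal entry `ε(b_{i,i+1}) a_i a_{i+1}` of a matrix in which the rows and columns `i` and
`i + 1` are multiplied; `a`, `b` are the entries of the corresponding `2 × 2` block. -/
def mulEps (ε : B →ₐ[k] A) (a : Fin 2 → A) (b : Pairs 2 → B) : A :=
  ε (b ⟨(0, 1), by decide⟩) * a 0 * a 1

theorem isMulti_mulEps (ε : B →ₐ[k] A) : IsMulti k (mulEps ε) := by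
  have hp : ∀ t : Pairs 2, t = ⟨(0, 1), by decide⟩ := by decide
  constructor
  · intro a b l x y
    fin_cases l <;> simp [mulEps, mul_add, add_mul]
  · intro a b l c x
    fin_cases l <;> simp [mulEps]
  · intro a b t x y
    rw [hp t]; simp [mulEps, add_mul]
  · intro a b t c x
    rw [hp t]; simp [mulEps]

/-- The secondary Hochschild differential `δ^ε_n : C^n → C^r`, `r = n + 1`:
`a_0 ε(∏ b_{0,l}) f(T^1_{n+1}) + ∑_i (-1)^{i+1} f(M_{i,i+1}) + (-1)^{n+1} f(T^0_n) a_n ε(∏ b_{l,n})`,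
where `M_{i,i+1}` results from contracting the block `{i, i+1}` to `ε(b_{i,i+1}) a_i a_{i+1}`. -/
def delta {n r : ℕ} (ε : B →ₐ[k] A) (h : n + 1 = r) : Cochain k A B n →ₗ[k] Cochain k A B r where
  toFun f := Cochain.ofFun
    (fun a b =>
      a ⟨0, by omega⟩ * ε (∏ l : Fin n, b (firstRow h l)) *
          f (blockA 1 (by omega : 1 + n ≤ r) a) (blockB 1 (by omega) b) +
        ∑ i : Fin n, (-1) ^ ((i : ℕ) + 1) *
          f (contractA (by omega : n + 2 = r + 1) i
              (mulEps ε (blockA i (by omega) a) (blockB i (by omega) b)) a)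
            (contractB 2 i b) +
        (-1) ^ (n + 1) * (f (blockA 0 (by omega : 0 + n ≤ r) a) (blockB 0 (by omega) b) *
          a ⟨n, by omega⟩ * ε (∏ l : Fin n, b (lastCol h l))))
    (((isMulti_first ε h f).add
      (IsMulti.sum _ fun i => (IsMulti.contract (by omega) i f (isMulti_mulEps ε)).neg_pow _)).add
      ((isMulti_last ε h f).neg_pow _))
  map_add' f g := by
    ext a b
    simp only [Cochain.ofFun_apply, add_apply, mul_add, add_mul, Finset.sum_add_distrib]
    abel
  map_smul' c f := by
    ext a b
    simp only [Cochain.ofFun_apply, smul_apply, mul_smul_comm, smul_mul_assoc, smul_add,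
      Finset.smul_sum, RingHom.id_apply]

end Differential

section Graded

universe u v

variable (k : Type*) [Field k] (V : ℤ → Type u) [∀ n, AddCommGroup (V n)] [∀ n, Module k (V n)]

/-- A bilinear operation of degree `0` on a `ℤ`-graded vector space: maps `V_m × V_n → V_r` for
`m + n = r`. -/
abbrev GradedOp : Type _ := ∀ m n r : ℤ, m + n = r → (V m →ₗ[k] V n →ₗ[k] V r)

/-- A pre-Lie system: operations `∘_i : V_m × V_n → V_{m+n}`, `0 ≤ i ≤ m`, with
`(f ∘_i g) ∘_j h = (f ∘_j h) ∘_{i+p} g` for `0 ≤ j ≤ i - 1` and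
`(f ∘_i g) ∘_j h = f ∘_i (g ∘_{j-i} h)` for `i ≤ j ≤ i + n`, where `f ∈ V_m`, `g ∈ V_n`, `h ∈ V_p`.
The values of `circ i` on `V_m` for `i` outside `[0, m]` carry no information. -/
structure IsPreLieSystem (circ : ℤ → GradedOp k V) : Prop where
  exchange : ∀ (m n p mn mp s : ℤ) (h₁ : m + n = mn) (h₂ : mn + p = s) (h₃ : m + p = mp)
    (h₄ : mp + n = s) (i j : ℤ), i ≤ m → 0 ≤ j → j ≤ i - 1 →
    ∀ (f : V m) (g : V n) (h : V p),
      circ j mn p s h₂ (circ i m n mn h₁ f g) h = circ (i + p) mp n s h₄ (circ j m p mp h₃ f h) g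
  nest : ∀ (m n p mn np s : ℤ) (h₁ : m + n = mn) (h₂ : mn + p = s) (h₃ : n + p = np)
    (h₄ : m + np = s) (i j : ℤ), 0 ≤ i → i ≤ m → i ≤ j → j ≤ i + n →
    ∀ (f : V m) (g : V n) (h : V p),
      circ j mn p s h₂ (circ i m n mn h₁ f g) h =
        circ i m np s h₄ f (circ (j - i) n p np h₃ g h)

variable {k V}

/-- `f ∘ g = ∑_{i=0}^{m} (-1)^{n i} f ∘_i g` for `f ∈ V_m`, `g ∈ V_n`. -/
noncomputable def totalComp (circ : ℤ → GradedOp k V) : GradedOp k V := fun m n r h =>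
  ∑ i ∈ Finset.Icc 0 m, (n * i).negOnePow • circ i m n r h

/-- `[f, g] = f ∘ g - (-1)^{m n} g ∘ f` for `f ∈ V_m`, `g ∈ V_n`. -/
noncomputable def commBracket (circ : ℤ → GradedOp k V) : GradedOp k V := fun m n r h =>
  totalComp circ m n r h -
    (m * n).negOnePow • (totalComp circ n m r ((add_comm n m).trans h)).flip

/-- A `ℤ`-graded Lie algebra over a field of any characteristic: graded antisymmetry, the graded
Jacobi identity, and the two identities `[x, x] = 0` (`x` of even degree) and `[x, [x, x]] = 0`
(`x` of odd degree), which follow from the former ones if `2` and `3` are invertible. -/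
structure IsGradedLie (br : GradedOp k V) : Prop where
  antisymm : ∀ (m n r : ℤ) (h : m + n = r) (h' : n + m = r) (x : V m) (y : V n),
    br m n r h x y = -((m * n).negOnePow • br n m r h' y x)
  jacobi : ∀ (m n p mn np mp s : ℤ) (h₁ : n + p = np) (h₂ : m + np = s) (h₃ : m + n = mn)
    (h₄ : mn + p = s) (h₅ : m + p = mp) (h₆ : n + mp = s) (x : V m) (y : V n) (z : V p),
    br m np s h₂ x (br n p np h₁ y z) =
      br mn p s h₄ (br m n mn h₃ x y) z +
        (m * n).negOnePow • br n mp s h₆ y (br m p mp h₅ x z)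
  self_even : ∀ (m r : ℤ) (h : m + m = r) (x : V m), Even m → br m m r h x x = 0
  self_odd : ∀ (m r s : ℤ) (h : m + m = r) (h' : m + r = s) (x : V m), Odd m →
    br m r s h' x (br m m r h x x) = 0

end Graded

section Secondary

universe w u v

variable (k : Type w) (A : Type u) (B : Type v) [Field k] [Ring A] [Algebra k A] [CommRing B]
  [Algebra k B]

/-- The cochains `C^n((A,B,ε);A)` for `n ∈ ℤ`; they vanish for `n < 0`. -/
def CochainZ : ℤ → Type (max u v)
  | Int.ofNat n => Cochain k A B n
  | Int.negSucc _ => PUnit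

instance (n : ℤ) : AddCommGroup (CochainZ k A B n) :=
  match n with
  | Int.ofNat n => inferInstanceAs (AddCommGroup (Cochain k A B n))
  | Int.negSucc _ => (inferInstance : AddCommGroup PUnit.{max u v + 1})

instance (n : ℤ) : Module k (CochainZ k A B n) :=
  match n with
  | Int.ofNat n => inferInstanceAs (Module k (Cochain k A B n))
  | Int.negSucc _ => (inferInstance : Module k PUnit.{max u v + 1})

/-- `∘_i : C^m × C^n → C^r`, `r = m + n - 1`, for integers `m, n`; it is `compAt` for `m, n, r ≥ 0` and
`0 ≤ i ≤ m - 1`, and set to `0` otherwise. -/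
def compZ (i : ℤ) : ∀ m n r : ℤ, m + n = r + 1 →
    (CochainZ k A B m →ₗ[k] CochainZ k A B n →ₗ[k] CochainZ k A B r)
  | Int.ofNat m, Int.ofNat n, Int.ofNat r, h =>
    if hi : 0 ≤ i ∧ i < m then
      (compAt (Int.ofNat_inj.1 h) ⟨i.toNat, by omega⟩ :
        Cochain k A B m →ₗ[k] Cochain k A B n →ₗ[k] Cochain k A B r)
    else 0
  | _, _, _, _ => 0

/-- `V_m = C^{m+1}((A,B,ε);A)`, which is `0` for `m < -1`. -/
abbrev ShiftedCochain (m : ℤ) : Type (max u v) := CochainZ k A B (m + 1)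

/-- The operations `∘_i : V_m × V_n → V_{m+n}`. -/
def circ (i : ℤ) : GradedOp k (ShiftedCochain k A B) := fun m n r h =>
  compZ k A B i (m + 1) (n + 1) (r + 1) (by omega)

variable {k A B}

/-- The differential `C^n → C^r`, `r = n + 1`, for integers `n`. -/
def deltaZ (ε : B →ₐ[k] A) : ∀ n r : ℤ, n + 1 = r → (CochainZ k A B n →ₗ[k] CochainZ k A B r)
  | Int.ofNat n, Int.ofNat r, h =>
    (delta ε (Int.ofNat_inj.1 h) : Cochain k A B n →ₗ[k] Cochain k A B r)
  | _, _, _ => 0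

/-- The cocycles in `C^n`. -/
def cocycles (ε : B →ₐ[k] A) (n : ℤ) : Submodule k (CochainZ k A B n) :=
  LinearMap.ker (deltaZ ε n (n + 1) rfl)

/-- The coboundaries in `C^n`. -/
def coboundaries (ε : B →ₐ[k] A) (n : ℤ) : Submodule k (CochainZ k A B n) :=
  LinearMap.range (deltaZ ε (n - 1) n (sub_add_cancel n 1))

/-- The secondary Hochschild cohomology `H^n((A,B,ε);A)`. -/
abbrev Cohomology (ε : B →ₐ[k] A) (n : ℤ) : Type (max u v) :=
  cocycles ε n ⧸ (coboundaries ε n).submoduleOf (cocycles ε n)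

/-- The cohomology with `H^{m+1}` placed in degree `m`. -/
abbrev ShiftedCohomology (ε : B →ₐ[k] A) (m : ℤ) : Type (max u v) := Cohomology ε (m + 1)

/-- The class of a cocycle. -/
def cls (ε : B →ₐ[k] A) (n : ℤ) (f : CochainZ k A B n) (hf : f ∈ cocycles ε n) : Cohomology ε n :=
  Submodule.Quotient.mk ⟨f, hf⟩

end Secondary

end SecHoch

/-! The argument is Gerstenhaber's, carried over to tensor matrices. Contracting a block is governed
by the monotone index map `squash`: an off-diagonal entry of the contracted matrix is the product of
the old entries over a fibre of that map. Two successive contractions therefore multiply over fibres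
of a composite map (`contractB_contractB`), and each pre-Lie identity reduces to an equality of two
index maps, together with a check that the inserted cochains see the same blocks (`compAt_exchange`,
`compAt_nest`).

For any pre-Lie system, the associator `(f ∘ g) ∘ h - f ∘ (g ∘ h)` retains only the terms in which
`g` and `h` occupy separate slots of `f`. It is thus symmetric in `g` and `h` up to the sign
`(-1)^{np}` (`totalComp_rightSymm`), and the graded commutator satisfies the Jacobi identity
(`isGradedLie_commBracket`). The identities for `[x, x]` and `[x, [x, x]]` come from the same
formula without dividing by `2` or `3`.

The differential is tied to the bracket by the 2-cochain `μ(a₁, a₂, b) = ε(b) a₁ a₂`: centrality of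
the image of `ε` gives `δ f = -[f, μ]` (`deltaZ_eq_commBracket`). Cocycles are then the elements
annihilated by `[·, μ]` and coboundaries the elements `[u, μ]`. Jacobi with `μ` in the last place
shows that brackets of cocycles are cocycles and that `[f, [u, μ]] = [[f, u], μ]` for a cocycle `f`.
The bracket descends, and its identities are inherited by representatives. Since cohomology is the
quotient of the cocycles by their intersection with the coboundaries, `δ² = 0` is not needed for
this. -/

namespace SecHoch

/-! ### Blocks and iterated contractions of tensor matrices -/

section ContractIdentities

variable {A B : Type*}

/-- The block lies to the right of the contracted index, so its start moves by `p - 1`. The shift is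
stated as `i + p = i' + 1` because `p = 0` moves it in the other direction. -/
theorem blockA_contractA_of_lt {m n p s : ℕ} (h : m + p = s + 1) (j : Fin m) (i i' : ℕ)
    (hj : j < i) (hi : i + n ≤ m) (hi' : i' + n ≤ s) (e : i + p = i' + 1) (x : A)
    (a : Fin s → A) :
    blockA i hi (contractA h j x a) = blockA i' hi' a := by
  funext l
  simp only [blockA, contractA]
  rw [dif_neg (by simp only [blockIdx, Fin.lt_def]; omega),
    dif_neg (by simp only [blockIdx, Fin.ext_iff]; omega)]
  exact congrArg a (Fin.ext (by simp only [blockIdx]; omega))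

theorem blockA_contractA_of_le {m n p s : ℕ} (h : m + n = s + 1) (i : Fin m) (j : ℕ)
    (hj : j + p ≤ i) (hj' : j + p ≤ m) (hs : j + p ≤ s) (x : A) (a : Fin s → A) :
    blockA j hj' (contractA h i x a) = blockA j hs a := by
  funext l
  simp only [blockA, contractA]
  rw [dif_pos (by simp only [blockIdx, Fin.lt_def]; omega)]
  rfl

theorem blockA_contractA {m n p np s : ℕ} (h : m + p = s + 1) (j : Fin m) (j' : Fin n) (i : ℕ)
    (hi : i + n ≤ m) (e : (j : ℕ) = i + j') (hnp : n + p = np + 1) (hs : i + np ≤ s) (x : A)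
    (a : Fin s → A) :
    blockA i hi (contractA h j x a) = contractA hnp j' x (blockA i hs a) := by
  funext l
  simp only [blockA, contractA]
  rcases lt_trichotomy (l : ℕ) j' with hl | hl | hl
  · rw [dif_pos (by simp only [blockIdx, Fin.lt_def]; omega), dif_pos (by rwa [Fin.lt_def])]
    rfl
  · rw [dif_neg (by simp only [blockIdx, Fin.lt_def]; omega),
      dif_pos (by simp only [blockIdx, Fin.ext_iff]; omega), dif_neg (by rw [Fin.lt_def]; omega),
      dif_pos (Fin.ext hl)]
  · rw [dif_neg (by simp only [blockIdx, Fin.lt_def]; omega),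
      dif_neg (by simp only [blockIdx, Fin.ext_iff]; omega), dif_neg (by rw [Fin.lt_def]; omega),
      dif_neg (by rw [Fin.ext_iff]; omega)]
    exact congrArg a (Fin.ext (by simp only [blockIdx]; omega))

theorem blockA_blockA {n p r : ℕ} (i j l : ℕ) (hi : i + n ≤ r) (hj : j + p ≤ n) (hl : l + p ≤ r)
    (e : l = i + j) (a : Fin r → A) : blockA j hj (blockA i hi a) = blockA l hl a := by
  subst e
  funext t
  simp only [blockA, blockIdx, Nat.add_assoc]

theorem blockB_blockB {n p r : ℕ} (i j l : ℕ) (hi : i + n ≤ r) (hj : j + p ≤ n) (hl : l + p ≤ r)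
    (e : l = i + j) (b : Pairs r → B) : blockB j hj (blockB i hi b) = blockB l hl b := by
  subst e
  funext t
  simp only [blockB, blockIdx, Nat.add_assoc]

theorem contractA_contractA_comm {m n p mn mp s : ℕ} (hmn : m + n = mn + 1) (hs : mn + p = s + 1)
    (hmp : m + p = mp + 1) (hs' : mp + n = s + 1) (i j : Fin m) (hji : j < i) (j' : Fin mn)
    (ej : (j' : ℕ) = j) (i' : Fin mp) (ei : (i' : ℕ) + 1 = i + p) (x y : A) (a : Fin s → A) :
    contractA hmn i y (contractA hs j' x a) = contractA hmp j x (contractA hs' i' y a) := by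
  funext l
  simp only [contractA, Fin.lt_def, Fin.ext_iff] at hji ⊢
  split_ifs <;> first | rfl | omega | skip
  -- Only the indices to the right of both blocks are left; the two sides shift them by the same
  -- total amount in a different order.
  congr 2
  omega

theorem contractA_contractA_nest {m n p mn np s : ℕ} (hmn : m + n = mn + 1) (hs : mn + p = s + 1)
    (hnp : n + p = np + 1) (hs' : m + np = s + 1) (i : Fin m) (j : Fin mn)
    (hij : (i : ℕ) ≤ j) (hjn : (j : ℕ) < i + n) (x y : A) (a : Fin s → A) :
    contractA hmn i y (contractA hs j x a) = contractA hs' i y a := by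
  funext l
  simp only [contractA, Fin.lt_def, Fin.ext_iff]
  split_ifs <;> first | rfl | omega | skip
  congr 2
  omega

theorem squash_mono (i n : ℕ) : Monotone (squash i n) := by
  intro s t hst
  unfold squash
  split_ifs <;> omega

theorem squash_add (i j n l : ℕ) : squash (i + j) n (i + l) = i + squash j n l := by
  unfold squash
  split_ifs <;> omega

theorem squash_lt {m n r : ℕ} (h : m + n = r + 1) (i : Fin m) (l : Fin r) :
    squash i n l < m := by
  unfold squash
  split_ifs <;> omega

variable [CommRing B]

/-- When the fibre over a position consists of one old position, the defining product has one
factor. This covers every entry away from the contracted row and column. -/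
theorem contractB_eq_single {m n r : ℕ} (i : Fin m) (b : Pairs r → B) (q : Pairs m) (t : Pairs r)
    (ht : ∀ u : Pairs r, (squash i n u.1.1 = (q.1.1 : ℕ) ∧ squash i n u.1.2 = (q.1.2 : ℕ)) ↔
      (u.1.1 : ℕ) = t.1.1 ∧ (u.1.2 : ℕ) = t.1.2) : contractB n i b q = b t := by
  unfold contractB
  rw [Finset.filter_congr (q := fun u => u = t) (fun u _ => by
    rw [ht u, Subtype.ext_iff, Prod.ext_iff, Fin.ext_iff, Fin.ext_iff]), Finset.filter_eq']
  simp

theorem blockB_contractB_of_lt {m n p s : ℕ} (j : Fin m) (i i' : ℕ)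
    (hj : j < i) (hi : i + n ≤ m) (hi' : i' + n ≤ s) (e : i + p = i' + 1) (b : Pairs s → B) :
    blockB i hi (contractB p j b) = blockB i' hi' b := by
  funext q
  refine contractB_eq_single j b _ _ fun u => ?_
  simp only [squash, blockIdx]
  split_ifs <;> omega

theorem blockB_contractB_of_le {m n p s : ℕ} (i : Fin m) (j : ℕ)
    (hj : j + p ≤ i) (hj' : j + p ≤ m) (hs : j + p ≤ s) (b : Pairs s → B) :
    blockB j hj' (contractB n i b) = blockB j hs b := by
  funext q
  refine contractB_eq_single i b _ _ fun u => ?_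
  simp only [squash, blockIdx]
  split_ifs <;> omega

theorem blockB_contractB {m n p np s : ℕ} (j : Fin m) (j' : Fin n) (i : ℕ)
    (hi : i + n ≤ m) (e : (j : ℕ) = i + j') (hnp : n + p = np + 1) (hs : i + np ≤ s)
    (b : Pairs s → B) :
    blockB i hi (contractB p j b) = contractB p j' (blockB i hs b) := by
  funext q
  symm
  refine Finset.prod_bij
    (fun t _ => ⟨(blockIdx i hs t.1.1, blockIdx i hs t.1.2), Nat.add_lt_add_left t.2 i⟩)
    ?_ ?_ ?_ fun _ _ => rfl
  · intro t ht
    simp only [Finset.mem_filter, Finset.mem_univ, true_and] at ht ⊢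
    simp only [blockIdx, e, squash_add]
    omega
  · intro t _ u _ htu
    simp only [blockIdx, Subtype.mk.injEq, Prod.mk.injEq, Fin.mk.injEq] at htu
    exact Subtype.ext (Prod.ext (Fin.ext (by omega)) (Fin.ext (by omega)))
  · intro t ht
    have hlt : (t.1.1 : ℕ) < t.1.2 := t.2
    have hq : (q.1.1 : ℕ) < q.1.2 := q.2
    simp only [Finset.mem_filter, Finset.mem_univ, true_and] at ht
    simp only [squash, blockIdx] at ht
    -- Surjectivity onto the fibre: the contracted index lies inside the block, so everything
    -- mapping into the block was already in the enlarged block of size `np`.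
    have h1 : i ≤ (t.1.1 : ℕ) ∧ (t.1.2 : ℕ) < i + np := by
      split_ifs at ht <;> omega
    refine ⟨⟨(⟨t.1.1 - i, by omega⟩, ⟨t.1.2 - i, by omega⟩), by
      simp only [Fin.lt_def]; omega⟩, ?_, ?_⟩
    · simp only [Finset.mem_filter, Finset.mem_univ, true_and]
      simp only [squash]
      split_ifs at ht ⊢ <;> omega
    · refine Subtype.ext (Prod.ext (Fin.ext ?_) (Fin.ext ?_)) <;> simp only [blockIdx] <;> omega

/-- A product of products over fibres is the product over the fibres of the composite, because the
inner fibres are disjoint and cover the outer one. -/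
theorem contractB_contractB {m n p mn s : ℕ} (hs : mn + p = s + 1) (i : Fin m) (j : Fin mn)
    (b : Pairs s → B) (q : Pairs m) :
    contractB n i (contractB p j b) q = ∏ t : Pairs s with
      squash i n (squash j p t.1.1) = (q.1.1 : ℕ) ∧
        squash i n (squash j p t.1.2) = (q.1.2 : ℕ), b t := by
  unfold contractB
  rw [← Finset.prod_biUnion]
  · refine Finset.prod_congr (Finset.ext fun t => ?_) fun _ _ => rfl
    simp only [Finset.mem_biUnion, Finset.mem_filter, Finset.mem_univ, true_and]
    constructor
    · rintro ⟨u, hu, h1, h2⟩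
      rw [h1, h2]
      exact hu
    · intro ht
      have hq : (q.1.1 : ℕ) < q.1.2 := q.2
      -- The intermediate position is strictly above the diagonal: otherwise monotonicity of the
      -- outer map would contradict `q.1.1 < q.1.2`.
      have hlt : squash j p t.1.1 < squash j p t.1.2 := by
        by_contra hc
        have := squash_mono i n (not_lt.1 hc)
        omega
      exact ⟨⟨(⟨_, squash_lt hs j t.1.1⟩, ⟨_, squash_lt hs j t.1.2⟩), hlt⟩, ht, rfl, rfl⟩
  · intro u _ v _ huv
    refine Finset.disjoint_left.2 fun t ht ht' => huv ?_
    simp only [Finset.mem_filter, Finset.mem_univ, true_and] at ht ht'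
    exact Subtype.ext (Prod.ext (Fin.ext (ht.1.symm.trans ht'.1)) (Fin.ext (ht.2.symm.trans ht'.2)))

theorem contractB_contractB_comm {m n p mn mp s : ℕ} (hs : mn + p = s + 1)
    (hs' : mp + n = s + 1) (i j : Fin m) (hji : j < i) (j' : Fin mn)
    (ej : (j' : ℕ) = j) (i' : Fin mp) (ei : (i' : ℕ) + 1 = i + p) (b : Pairs s → B) :
    contractB n i (contractB p j' b) = contractB p j (contractB n i' b) := by
  have key : ∀ l, squash i n (squash j' p l) = squash j p (squash i' n l) := by
    intro l
    rw [Fin.lt_def] at hji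
    unfold squash
    split_ifs <;> omega
  funext q
  rw [contractB_contractB hs, contractB_contractB hs']
  simp only [key]

theorem contractB_contractB_nest {m n p mn np s : ℕ} (hs : mn + p = s + 1)
    (hnp : n + p = np + 1) (i : Fin m) (j : Fin mn)
    (hij : (i : ℕ) ≤ j) (hjn : (j : ℕ) < i + n) (b : Pairs s → B) :
    contractB n i (contractB p j b) = contractB np i b := by
  have key : ∀ l, squash i n (squash j p l) = squash i np l := by
    intro l
    unfold squash
    split_ifs <;> omega
  funext q
  rw [contractB_contractB hs]
  simp only [key]
  rfl

end ContractIdentities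

/-! ### The pre-Lie identities for cochains -/

section CompAt

variable {k A B : Type*} [Field k] [Ring A] [Algebra k A] [CommRing B] [Algebra k B]

theorem compAt_apply {m n r : ℕ} (h : m + n = r + 1) (i : Fin m) (f : Cochain k A B m)
    (g : Cochain k A B n) (a : Fin r → A) (b : Pairs r → B) :
    compAt h i f g a b =
      f (contractA h i (g (blockA i (by omega : (i : ℕ) + n ≤ r) a) (blockB i (by omega) b)) a)
        (contractB n i b) := rfl

theorem compAt_exchange {m n p mn mp s : ℕ} (hmn : m + n = mn + 1) (hs : mn + p = s + 1)
    (hmp : m + p = mp + 1) (hs' : mp + n = s + 1) (i j : Fin m) (hji : j < i) (j' : Fin mn)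
    (ej : (j' : ℕ) = j) (i' : Fin mp) (ei : (i' : ℕ) + 1 = i + p) (f : Cochain k A B m)
    (g : Cochain k A B n) (h : Cochain k A B p) :
    compAt hs j' (compAt hmn i f g) h = compAt hs' i' (compAt hmp j f h) g := by
  ext a b
  have hji' : (j : ℕ) < i := hji
  obtain ⟨j', hj'⟩ := j'
  dsimp only at ej
  subst ej
  simp only [compAt_apply]
  rw [contractB_contractB_comm hs hs' i j hji ⟨j, hj'⟩ rfl i' ei,
    contractA_contractA_comm hmn hs hmp hs' i j hji ⟨j, hj'⟩ rfl i' ei,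
    blockA_contractA_of_lt hs ⟨j, hj'⟩ i i' (by omega) (by omega) (by omega) (by omega),
    blockB_contractB_of_lt ⟨j, hj'⟩ i i' (by omega) (by omega) (by omega) (by omega),
    blockA_contractA_of_le hs' i' j (by omega) (by omega) (by omega),
    blockB_contractB_of_le i' j (by omega) (by omega) (by omega)]

theorem compAt_nest {m n p mn np s : ℕ} (hmn : m + n = mn + 1) (hs : mn + p = s + 1)
    (hnp : n + p = np + 1) (hs' : m + np = s + 1) (i : Fin m) (j : Fin mn) (j' : Fin n)
    (ej : (j : ℕ) = i + j') (f : Cochain k A B m) (g : Cochain k A B n) (h : Cochain k A B p) :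
    compAt hs j (compAt hmn i f g) h = compAt hs' i f (compAt hnp j' g h) := by
  ext a b
  simp only [compAt_apply]
  rw [contractB_contractB_nest hs hnp i j (by omega) (by omega),
    contractA_contractA_nest hmn hs hnp hs' i j (by omega) (by omega),
    blockA_contractA hs j j' i (by omega) ej hnp (by omega),
    blockB_contractB j j' i (by omega) ej hnp (by omega),
    blockA_blockA i j' j (by omega) (by omega) (by omega) ej,
    blockB_blockB i j' j (by omega) (by omega) (by omega) ej]

end CompAt

/-! ### Extension to integer degrees -/

section CompZ

variable {k A B : Type*} [Field k] [Ring A] [Algebra k A] [CommRing B] [Algebra k B]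

theorem CochainZ.subsingleton {n : ℤ} (hn : n < 0) : Subsingleton (CochainZ k A B n) :=
  match n, hn with
  | Int.negSucc _, _ => inferInstanceAs (Subsingleton PUnit)

theorem CochainZ.eq_zero {n : ℤ} (hn : n < 0) (x : CochainZ k A B n) : x = 0 :=
  (CochainZ.subsingleton hn).elim _ _

theorem compZ_natCast {i m n r : ℕ} (h : m + n = r + 1) (h' : (m : ℤ) + n = r + 1) (hi : i < m)
    (f : CochainZ k A B m) (g : CochainZ k A B n) :
    compZ k A B (i : ℤ) (m : ℤ) (n : ℤ) (r : ℤ) h' f g =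
      (show CochainZ k A B r from compAt (k := k) (A := A) (B := B) h ⟨i, hi⟩ f g) := by
  have e : compZ k A B (i : ℤ) (Int.ofNat m) (Int.ofNat n) (Int.ofNat r) h' =
      (compAt h ⟨i, hi⟩ : Cochain k A B m →ₗ[k] Cochain k A B n →ₗ[k] Cochain k A B r) :=
    dif_pos (show 0 ≤ (i : ℤ) ∧ (i : ℤ) < m by omega)
  exact LinearMap.congr_fun (LinearMap.congr_fun e f) g

theorem compZ_exchange {m n p mn mp s : ℤ} (hmn : m + n = mn + 1) (hs : mn + p = s + 1)
    (hmp : m + p = mp + 1) (hs' : mp + n = s + 1) (i j i' : ℤ) (hi : i < m) (hj : 0 ≤ j)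
    (hji : j < i) (ei : i' + 1 = i + p) (f : CochainZ k A B m) (g : CochainZ k A B n)
    (h : CochainZ k A B p) :
    compZ k A B j mn p s hs (compZ k A B i m n mn hmn f g) h =
      compZ k A B i' mp n s hs' (compZ k A B j m p mp hmp f h) g := by
  rcases lt_or_ge n 0 with hn | hn
  · rw [CochainZ.eq_zero hn g]; simp only [map_zero, LinearMap.zero_apply]
  rcases lt_or_ge p 0 with hp | hp
  · rw [CochainZ.eq_zero hp h]; simp only [map_zero, LinearMap.zero_apply]
  -- From `0 ≤ j < i < m` one has `m ≥ 2`, so with `n, p ≥ 0` all the remaining degrees are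
  -- nonnegative as well.
  lift m to ℕ using by omega
  lift n to ℕ using hn
  lift p to ℕ using hp
  lift mn to ℕ using by omega
  lift mp to ℕ using by omega
  lift s to ℕ using by omega
  lift j to ℕ using hj
  lift i to ℕ using by omega
  lift i' to ℕ using by omega
  rw [compZ_natCast (by omega) hmn (by omega), compZ_natCast (by omega) hs (by omega),
    compZ_natCast (by omega) hmp (by omega), compZ_natCast (by omega) hs' (by omega)]
  refine compAt_exchange (k := k) (A := A) (B := B) _ _ _ _ _ _ ?_ _ ?_ _ ?_ _ _ _
  · rw [Fin.mk_lt_mk]; omega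
  · rfl
  · simp only; omega

theorem compZ_nest {m n p mn np s : ℤ} (hmn : m + n = mn + 1) (hs : mn + p = s + 1)
    (hnp : n + p = np + 1) (hs' : m + np = s + 1) (i j j' : ℤ) (hi : 0 ≤ i) (him : i < m)
    (hij : i ≤ j) (hjn : j < i + n) (ej : j' = j - i) (f : CochainZ k A B m)
    (g : CochainZ k A B n) (h : CochainZ k A B p) :
    compZ k A B j mn p s hs (compZ k A B i m n mn hmn f g) h =
      compZ k A B i m np s hs' f (compZ k A B j' n p np hnp g h) := by
  rcases lt_or_ge p 0 with hp | hp
  · rw [CochainZ.eq_zero hp h]; simp only [map_zero]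
  -- The range `i ≤ j < i + n` forces `n ≥ 1`, so `p` is the only degree that had to be tested for
  -- negativity.
  have hn : 0 ≤ n := by omega
  have hmn' : 0 ≤ mn := by omega
  have hnp' : 0 ≤ np := by omega
  have hs₀ : 0 ≤ s := by omega
  have hj : 0 ≤ j := by omega
  have hj' : 0 ≤ j' := by omega
  lift m to ℕ using by omega
  lift n to ℕ using hn
  lift p to ℕ using hp
  lift mn to ℕ using hmn'
  lift np to ℕ using hnp'
  lift s to ℕ using hs₀
  lift j to ℕ using hj
  lift i to ℕ using hi
  lift j' to ℕ using hj'
  rw [compZ_natCast (by omega) hmn (by omega), compZ_natCast (by omega) hs (by omega),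
    compZ_natCast (by omega) hnp (by omega), compZ_natCast (by omega) hs' (by omega)]
  refine compAt_nest (k := k) (A := A) (B := B) _ _ _ _ _ _ _ ?_ _ _ _
  simp only; omega

variable (k A B) in
theorem isPreLieSystem_circ : IsPreLieSystem k (ShiftedCochain k A B) (circ k A B) where
  exchange m n p mn mp s h₁ h₂ h₃ h₄ i j hi hj hji f g h :=
    compZ_exchange _ _ _ _ i j (i + p) (by omega) hj (by omega) (by omega) f g h
  nest m n p mn np s h₁ h₂ h₃ h₄ i j hi him hij hjn f g h :=
    compZ_nest _ _ _ _ i j (j - i) hi (by omega) hij (by omega) rfl f g h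

end CompZ

/-! ### The graded Lie algebra of a pre-Lie system -/

section PreLie

universe u

variable {k : Type*} [Field k] {V : ℤ → Type u} [∀ n, AddCommGroup (V n)] [∀ n, Module k (V n)]
  {circ : ℤ → GradedOp k V}

theorem totalComp_apply (circ : ℤ → GradedOp k V) {m n r : ℤ} (h : m + n = r) (f : V m)
    (g : V n) : totalComp circ m n r h f g =
      ∑ i ∈ Finset.Icc 0 m, (n * i).negOnePow • circ i m n r h f g := by
  simp only [totalComp, LinearMap.sum_apply, Units.smul_def, LinearMap.smul_apply]

theorem commBracket_apply (circ : ℤ → GradedOp k V) {m n r : ℤ} (h : m + n = r)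
    (h' : n + m = r) (f : V m) (g : V n) : commBracket circ m n r h f g =
      totalComp circ m n r h f g - (m * n).negOnePow • totalComp circ n m r h' g f := by
  simp only [commBracket, LinearMap.sub_apply, Units.smul_def, LinearMap.smul_apply,
    LinearMap.flip_apply]

theorem totalComp_totalComp (circ : ℤ → GradedOp k V) {m n p mn s : ℤ} (h₁ : m + n = mn)
    (h₂ : mn + p = s) (f : V m) (g : V n) (h : V p) :
    totalComp circ mn p s h₂ (totalComp circ m n mn h₁ f g) h =
      ∑ x ∈ Finset.Icc 0 m ×ˢ Finset.Icc 0 mn, (n * x.1 + p * x.2).negOnePow •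
        circ x.2 mn p s h₂ (circ x.1 m n mn h₁ f g) h := by
  rw [Finset.sum_product_right, totalComp_apply]
  refine Finset.sum_congr rfl fun j _ => ?_
  rw [totalComp_apply, map_sum, LinearMap.sum_apply, Finset.smul_sum]
  refine Finset.sum_congr rfl fun i _ => ?_
  simp only [Units.smul_def, map_zsmul, LinearMap.smul_apply]
  rw [smul_smul, add_comm, Int.negOnePow_add, Units.val_mul]

theorem totalComp_totalComp_right (circ : ℤ → GradedOp k V) {m n p np s : ℤ} (h₁ : n + p = np)
    (h₂ : m + np = s) (f : V m) (g : V n) (h : V p) :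
    totalComp circ m np s h₂ f (totalComp circ n p np h₁ g h) =
      ∑ x ∈ Finset.Icc 0 m ×ˢ Finset.Icc 0 n, (np * x.1 + p * x.2).negOnePow •
        circ x.1 m np s h₂ f (circ x.2 n p np h₁ g h) := by
  rw [Finset.sum_product, totalComp_apply]
  refine Finset.sum_congr rfl fun j _ => ?_
  rw [totalComp_apply, map_sum, Finset.smul_sum]
  refine Finset.sum_congr rfl fun i _ => ?_
  simp only [Units.smul_def, map_zsmul]
  rw [smul_smul, Int.negOnePow_add, Units.val_mul]

/-- The terms of `(f ∘ g) ∘ h` in which `h` is inserted to the left of `g`. -/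
noncomputable def leftTerms (circ : ℤ → GradedOp k V) {m n p mn s : ℤ} (h₁ : m + n = mn) (h₂ : mn + p = s)
    (f : V m) (g : V n) (h : V p) : V s :=
  ∑ x ∈ (Finset.Icc 0 m ×ˢ Finset.Icc 0 m).filter (fun x => x.2 < x.1),
    (n * x.1 + p * x.2).negOnePow • circ x.2 mn p s h₂ (circ x.1 m n mn h₁ f g) h

/-- The terms `(f ∘_i g) ∘_j h` fall into three groups: `j < i` (`h` left of `g`), `j > i + n` (`h`
right of `g`), and `i ≤ j ≤ i + n` (`h` inside `g`). The last group is exactly `f ∘ (g ∘ h)`, and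
the exchange rule turns the second into the first with `g` and `h` interchanged. -/
theorem totalComp_assoc (H : IsPreLieSystem k V circ) {m n p mn np mp s : ℤ} (hn : -1 ≤ n)
    (h₁ : m + n = mn) (h₂ : mn + p = s) (h₃ : n + p = np)
    (h₄ : m + np = s) (h₅ : m + p = mp) (h₆ : mp + n = s) (f : V m) (g : V n) (h : V p) :
    totalComp circ mn p s h₂ (totalComp circ m n mn h₁ f g) h -
        totalComp circ m np s h₄ f (totalComp circ n p np h₃ g h) =
      leftTerms circ h₁ h₂ f g h + (n * p).negOnePow • leftTerms circ h₅ h₆ f h g := by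
  rw [totalComp_totalComp, totalComp_totalComp_right, sub_eq_iff_eq_add,
    ← Finset.sum_filter_add_sum_filter_not _ (fun x : ℤ × ℤ => x.2 < x.1), add_assoc]
  congr 1
  -- Here `-1 ≤ n` enters: `j < i ≤ m` then gives `j ≤ m + n`, so the bounds `j ≤ m` and `j ≤ mn`
  -- cut out the same pairs.
  · refine Finset.sum_congr (Finset.ext fun x => ?_) fun _ _ => rfl
    simp only [Finset.mem_filter, Finset.mem_product, Finset.mem_Icc]
    omega
  rw [← Finset.sum_filter_add_sum_filter_not _ (fun x : ℤ × ℤ => x.1 + n < x.2),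
    Finset.filter_filter, Finset.filter_filter]
  congr 1
  · rw [leftTerms, Finset.smul_sum]
    -- Removing `g` moves the slot of `h` from `j` back to `j - n`; the sign `p * j` thereby splits
    -- off `(-1)^{np}`.
    refine Finset.sum_bij' (fun x _ => (x.2 - n, x.1)) (fun x _ => (x.2, x.1 + n)) ?_ ?_ ?_ ?_ ?_
    · intro x hx
      simp only [Finset.mem_filter, Finset.mem_product, Finset.mem_Icc] at hx ⊢
      omega
    · intro x hx
      simp only [Finset.mem_filter, Finset.mem_product, Finset.mem_Icc] at hx ⊢
      omega
    · intro x _; ext <;> simp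
    · intro x _; ext <;> simp
    · intro x hx
      simp only [Finset.mem_filter, Finset.mem_product, Finset.mem_Icc] at hx
      rw [smul_smul, ← Int.negOnePow_add,
        H.exchange m p n mp mn s h₅ h₆ h₁ h₂ (x.2 - n) x.1 (by omega) (by omega) (by omega)]
      simp only [sub_add_cancel]
      congr 2
      ring
  · refine Finset.sum_bij' (fun x _ => (x.1, x.2 - x.1)) (fun x _ => (x.1, x.1 + x.2))
      ?_ ?_ ?_ ?_ ?_
    · intro x hx
      simp only [Finset.mem_filter, Finset.mem_product, Finset.mem_Icc] at hx ⊢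
      omega
    · intro x hx
      simp only [Finset.mem_filter, Finset.mem_product, Finset.mem_Icc] at hx ⊢
      omega
    · intro x _; ext <;> simp
    · intro x _; ext <;> simp
    · intro x hx
      simp only [Finset.mem_filter, Finset.mem_product, Finset.mem_Icc] at hx
      rw [H.nest m n p mn np s h₁ h₂ h₃ h₄ x.1 x.2 (by omega) (by omega) (by omega) (by omega)]
      congr 2
      subst h₃
      ring

/-- The composition of a pre-Lie system is graded right-symmetric. -/
theorem totalComp_rightSymm (H : IsPreLieSystem k V circ) (hV : ∀ n < -1, Subsingleton (V n))
    {m n p mn np mp s : ℤ} (h₁ : m + n = mn) (h₂ : mn + p = s) (h₃ : n + p = np)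
    (h₃' : p + n = np) (h₄ : m + np = s) (h₅ : m + p = mp) (h₆ : mp + n = s) (f : V m) (g : V n)
    (h : V p) :
    totalComp circ mn p s h₂ (totalComp circ m n mn h₁ f g) h -
        totalComp circ m np s h₄ f (totalComp circ n p np h₃ g h) =
      (n * p).negOnePow • (totalComp circ mp n s h₆ (totalComp circ m p mp h₅ f h) g -
        totalComp circ m np s h₄ f (totalComp circ p n np h₃' h g)) := by
  rcases lt_or_ge n (-1) with hn | hn
  · have := hV n hn
    rw [Subsingleton.elim g 0]
    simp only [map_zero, LinearMap.zero_apply, sub_zero, smul_zero]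
  rcases lt_or_ge p (-1) with hp | hp
  · have := hV p hp
    rw [Subsingleton.elim h 0]
    simp only [map_zero, LinearMap.zero_apply, sub_zero, smul_zero]
  -- Both associators are sums of the same two families of left terms, and the square of `(-1)^{np}`
  -- is `1`.
  rw [totalComp_assoc H hn h₁ h₂ h₃ h₄ h₅ h₆, totalComp_assoc H hp h₅ h₆ h₃' h₄ h₁ h₂,
    smul_add, smul_smul, mul_comm p n, Int.units_mul_self, one_smul, add_comm]

/-- The commutator of a pre-Lie system is a graded Lie bracket. -/
theorem isGradedLie_commBracket (H : IsPreLieSystem k V circ)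
    (hV : ∀ n < -1, Subsingleton (V n)) : IsGradedLie (commBracket circ) where
  antisymm m n r h h' x y := by
    rw [commBracket_apply circ h h', commBracket_apply circ h' h, smul_sub, smul_smul,
      mul_comm n m, Int.units_mul_self, one_smul, neg_sub]
  jacobi m n p mn np mp s h₁ h₂ h₃ h₄ h₅ h₆ x y z := by
    -- Right symmetry is applied once with each of `x`, `y`, `z` as the outer left factor; Jacobi is
    -- a signed sum of these three relations.
    have e₁ := totalComp_rightSymm H hV h₃ h₄ h₁ ((add_comm p n).trans h₁) h₂ h₅
      ((add_comm mp n).trans h₆) x y z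
    have e₂ := totalComp_rightSymm H hV ((add_comm n m).trans h₃) h₄ h₅ ((add_comm p m).trans h₅)
      h₆ h₁ ((add_comm np m).trans h₂) y x z
    have e₃ := totalComp_rightSymm H hV ((add_comm p m).trans h₅) ((add_comm mp n).trans h₆)
      h₃ ((add_comm n m).trans h₃) (by omega) ((add_comm p n).trans h₁)
      ((add_comm np m).trans h₂) z x y
    simp only [commBracket_apply circ h₁ ((add_comm p n).trans h₁),
      commBracket_apply circ h₂ ((add_comm np m).trans h₂),
      commBracket_apply circ h₃ ((add_comm n m).trans h₃),
      commBracket_apply circ h₄ ((add_comm p mn).trans (by omega)),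
      commBracket_apply circ h₅ ((add_comm p m).trans h₅),
      commBracket_apply circ h₆ ((add_comm mp n).trans h₆), map_sub, LinearMap.sub_apply,
      Units.smul_def, map_zsmul, LinearMap.smul_apply, smul_sub] at e₁ e₂ e₃ ⊢
    subst h₁ h₃ h₅
    simp only [mul_add, add_mul, Int.negOnePow_add, Units.val_mul, mul_comm n m] at *
    -- The twelve iterated compositions become atoms, which leaves a linear identity to check for
    -- each of the eight choices of signs.
    generalize totalComp circ _ _ s _ x (totalComp circ _ _ _ _ y z) = x1 at *
    generalize totalComp circ _ _ s _ x (totalComp circ _ _ _ _ z y) = x2 at *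
    generalize totalComp circ _ _ s _ y (totalComp circ _ _ _ _ x z) = x3 at *
    generalize totalComp circ _ _ s _ y (totalComp circ _ _ _ _ z x) = x4 at *
    generalize totalComp circ _ _ s _ z (totalComp circ _ _ _ _ x y) = x5 at *
    generalize totalComp circ _ _ s _ z (totalComp circ _ _ _ _ y x) = x6 at *
    generalize totalComp circ _ _ s _ (totalComp circ _ _ _ _ x y) z = y1 at *
    generalize totalComp circ _ _ s _ (totalComp circ _ _ _ _ x z) y = y2 at *
    generalize totalComp circ _ _ s _ (totalComp circ _ _ _ _ y x) z = y3 at *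
    generalize totalComp circ _ _ s _ (totalComp circ _ _ _ _ y z) x = y4 at *
    generalize totalComp circ _ _ s _ (totalComp circ _ _ _ _ z x) y = y5 at *
    generalize totalComp circ _ _ s _ (totalComp circ _ _ _ _ z y) x = y6 at *
    rcases Int.units_eq_one_or (m * n).negOnePow with a1 | a1 <;>
    rcases Int.units_eq_one_or (m * p).negOnePow with a2 | a2 <;>
    rcases Int.units_eq_one_or (n * p).negOnePow with a3 | a3 <;>
    · linear_combination (norm := skip) (-1 : ℤ) • e₁ + ((m * n).negOnePow : ℤ) • e₂ -
        (((m * p).negOnePow : ℤ) * (n * p).negOnePow) • e₃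
      simp only [a1, a2, a3, Units.val_one, Units.val_neg]
      module
  self_even m r h x hm := by
    rw [commBracket_apply circ h h, Int.negOnePow_even _ (hm.mul_left m), one_smul, sub_self]
  self_odd m r s h h' x hm := by
    -- For `x` of odd degree the associator of `x, x, x` equals its own negative, so twice it
    -- vanishes; and `-[x, [x, x]]` is exactly twice this associator.
    have e := totalComp_rightSymm H hV h ((add_comm r m).trans h') h h h' h
      ((add_comm r m).trans h') x x x
    have hr : Even (m * r) := by rw [← h]; exact (Even.add_self m).mul_left m
    rw [commBracket_apply circ h' ((add_comm r m).trans h'), commBracket_apply circ h h,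
      Int.negOnePow_even _ hr]
    rw [Int.negOnePow_odd _ (hm.mul hm)] at e ⊢
    simp only [Units.smul_def, Units.val_one, Units.val_neg, one_smul, neg_smul, map_sub, map_neg,
      LinearMap.sub_apply, LinearMap.neg_apply] at e ⊢
    rw [eq_neg_iff_add_eq_zero] at e
    rw [← neg_eq_zero, ← e]
    abel

end PreLie

/-! ### The differential as a bracket with the multiplication -/

section Multiplication

variable {k A B : Type*} [Field k] [Ring A] [Algebra k A] [CommRing B] [Algebra k B]

/-- The multiplication `(a_1, a_2, b) ↦ ε(b) a_1 a_2` as a cochain in `C^2`. -/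
def mulCochain (ε : B →ₐ[k] A) : Cochain k A B 2 := Cochain.ofFun (mulEps ε) (isMulti_mulEps ε)

/-- Contracting all indices but the first of a matrix to size two leaves one off-diagonal entry,
whose fibre is the first row. It identifies the `ε`-factor in the first term of the differential. -/
theorem contractB_one_firstRow {n r : ℕ} (h : n + 1 = r) (b : Pairs r → B) :
    contractB (m := 2) n 1 b ⟨(0, 1), by decide⟩ = ∏ l : Fin n, b (firstRow h l) := by
  symm
  refine Finset.prod_bij (fun l _ => firstRow h l) ?_ (fun _ _ _ _ e => firstRow_injective h e) ?_
    fun _ _ => rfl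
  · intro l _
    simp only [Finset.mem_filter, Finset.mem_univ, true_and]
    simp [firstRow, squash]
    omega
  · intro t ht
    have hlt : (t.1.1 : ℕ) < t.1.2 := t.2
    simp only [Finset.mem_filter, Finset.mem_univ, true_and] at ht
    have h1 : (t.1.1 : ℕ) = 0 := by
      have := ht.1
      simp only [squash, Fin.val_one, Fin.val_zero] at this
      split_ifs at this <;> omega
    refine ⟨⟨t.1.2 - 1, by omega⟩, Finset.mem_univ _,
      Subtype.ext (Prod.ext (Fin.ext h1.symm) (Fin.ext ?_))⟩
    simp only [firstRow]
    omega

theorem contractB_zero_lastCol {n r : ℕ} (h : n + 1 = r) (b : Pairs r → B) :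
    contractB (m := 2) n 0 b ⟨(0, 1), by decide⟩ = ∏ l : Fin n, b (lastCol h l) := by
  symm
  refine Finset.prod_bij (fun l _ => lastCol h l) ?_ (fun _ _ _ _ e => lastCol_injective h e) ?_
    fun _ _ => rfl
  · intro l _
    simp only [Finset.mem_filter, Finset.mem_univ, true_and]
    simp [lastCol, squash]
  · intro t ht
    have hlt : (t.1.1 : ℕ) < t.1.2 := t.2
    simp only [Finset.mem_filter, Finset.mem_univ, true_and] at ht
    have h1 : (t.1.2 : ℕ) = n := by
      have := ht.2
      simp only [squash, Fin.val_one, Fin.val_zero] at this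
      split_ifs at this <;> omega
    refine ⟨⟨t.1.1, by omega⟩, Finset.mem_univ _,
      Subtype.ext (Prod.ext (Fin.ext rfl) (Fin.ext h1.symm))⟩

theorem neg_one_pow_smul_eq_mul (e : ℕ) (x : A) : (-1 : k) ^ e • x = (-1) ^ e * x := by
  rcases neg_one_pow_eq_or k e with h | h <;> rcases Nat.even_or_odd e with h' | h' <;>
    simp [h'.neg_one_pow]

/-- The outer terms of the differential are `μ ∘_1 f` and `μ ∘_0 f`, the inner ones are `f ∘_i μ`.
Centrality is used to move the `ε`-factors of the outer terms to the front, where `μ` has them. -/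
theorem delta_eq_compAt (ε : B →ₐ[k] A) (hε : ∀ β : B, ε β ∈ Subalgebra.center k A) {n r : ℕ}
    (h : n + 1 = r) (f : Cochain k A B n) :
    delta ε h f = compAt (by omega) 1 (mulCochain ε) f +
      ∑ i : Fin n, (-1 : k) ^ ((i : ℕ) + 1) • compAt (by omega) i f (mulCochain ε) +
      (-1 : k) ^ (n + 1) • compAt (by omega) 0 (mulCochain ε) f := by
  have hc : ∀ (β : B) (x : A), x * ε β = ε β * x := fun β x =>
    Subalgebra.mem_center_iff.1 (hε β) x
  ext a b
  simp only [add_apply, sum_apply, smul_apply, neg_one_pow_smul_eq_mul]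
  change (_ * _ * _ + _ + _ : A) = _
  congr 1
  · congr 1
    rw [compAt_apply]
    change _ = (ε _ * _ * _ : A)
    rw [contractB_one_firstRow h, hc]
    rfl
  · congr 1
    rw [compAt_apply]
    change _ = (ε _ * _ * _ : A)
    rw [contractB_zero_lastCol h, hc, mul_assoc (ε _)]
    congr 2
    simp only [contractA]
    exact congrArg a (Fin.ext (Nat.add_sub_cancel_left 1 n).symm)

theorem natCast_negOnePow_smul {M : Type*} [AddCommGroup M] [Module k M] (i : ℕ) (x : M) :
    (i : ℤ).negOnePow • x = (-1 : k) ^ i • x := by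
  rcases Nat.even_or_odd i with h | h
  · rw [Int.negOnePow_even _ (by exact_mod_cast h), h.neg_one_pow, one_smul, one_smul]
  · rw [Int.negOnePow_odd _ (by exact_mod_cast h), h.neg_one_pow, Units.smul_def]
    simp

theorem add_sum_add_eq_neg_sub {M : Type*} [AddCommGroup M] [Module k M] (n : ℕ) (x y : M)
    (G : Fin n → M) :
    x + ∑ i : Fin n, (-1 : k) ^ ((i : ℕ) + 1) • G i + (-1 : k) ^ (n + 1) • y =
      -(∑ i : Fin n, ((i : ℕ) : ℤ).negOnePow • G i - (((n + 1 : ℕ) : ℤ).negOnePow • y + x)) := by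
  have h : ∀ i : Fin n, (-1 : k) ^ ((i : ℕ) + 1) • G i = -((-1 : k) ^ (i : ℕ) • G i) := by
    intro i
    rw [pow_succ, mul_neg, mul_one, neg_smul]
  simp only [natCast_negOnePow_smul (k := k), h, Finset.sum_neg_distrib]
  abel

theorem sum_Icc_zero_int {M : Type*} [AddCommMonoid M] {m : ℤ} {n : ℕ} (h : m + 1 = n)
    (F : ℤ → M) : ∑ i ∈ Finset.Icc 0 m, F i = ∑ i : Fin n, F (i : ℕ) := by
  symm
  refine Finset.sum_bij (fun i _ => ((i : ℕ) : ℤ)) ?_ ?_ ?_ fun _ _ => rfl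
  · intro i _
    rw [Finset.mem_Icc]
    omega
  · intro i _ j _ e
    exact Fin.ext (by exact_mod_cast e)
  · intro i hi
    rw [Finset.mem_Icc] at hi
    exact ⟨⟨i.toNat, by omega⟩, Finset.mem_univ _, by simp only; omega⟩

/-- `mulCochain` as an element of degree `1` of the shifted cochains. -/
def mulShifted (ε : B →ₐ[k] A) : ShiftedCochain k A B 1 := mulCochain ε

theorem deltaZ_natCast_eq (ε : B →ₐ[k] A) (hε : ∀ β : B, ε β ∈ Subalgebra.center k A) (n : ℕ)
    (m : ℤ) (hm : m + 1 = n) (f : CochainZ k A B (n : ℤ)) :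
    deltaZ ε (n : ℤ) ((n + 1 : ℕ) : ℤ) (by omega) f =
      -(∑ i ∈ Finset.Icc 0 m, (1 * i).negOnePow •
          compZ k A B i (n : ℤ) (1 + 1) ((n + 1 : ℕ) : ℤ) (by omega) f (mulShifted ε) -
        (m * 1).negOnePow • ∑ i ∈ Finset.Icc 0 1, (m * i).negOnePow •
          compZ k A B i (1 + 1) (n : ℤ) ((n + 1 : ℕ) : ℤ) (by omega) (mulShifted ε) f) := by
  have e₀ : compZ k A B 0 (1 + 1) (n : ℤ) ((n + 1 : ℕ) : ℤ) (by omega) (mulShifted ε) f = _ :=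
    compZ_natCast (k := k) (A := A) (B := B) (i := 0) (m := 2) (n := n) (r := n + 1)
      (by omega) (by omega) (by omega) (mulCochain ε) f
  have e₁ : compZ k A B 1 (1 + 1) (n : ℤ) ((n + 1 : ℕ) : ℤ) (by omega) (mulShifted ε) f = _ :=
    compZ_natCast (k := k) (A := A) (B := B) (i := 1) (m := 2) (n := n) (r := n + 1)
      (by omega) (by omega) (by omega) (mulCochain ε) f
  have e₂ : ∀ i : Fin n, compZ k A B ((i : ℕ) : ℤ) (n : ℤ) (1 + 1) ((n + 1 : ℕ) : ℤ) (by omega) f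
      (mulShifted ε) = _ := fun i =>
    compZ_natCast (k := k) (A := A) (B := B) (m := n) (n := 2) (r := n + 1)
      (by omega) (by omega) i.2 f (mulCochain ε)
  have hm' : m = n - 1 := by omega
  -- Since `n = m + 1`, the sign `(-1)^{n+1}` of the last term of the differential is the sign
  -- `(-1)^m` in the commutator.
  have s₀ : (m * 1).negOnePow = ((n + 1 : ℕ) : ℤ).negOnePow := by
    rw [hm', mul_one, Int.negOnePow_sub, Nat.cast_add, Int.negOnePow_add]
    rfl
  rw [sum_Icc_zero_int hm, sum_Icc_zero_int (n := 2) (by norm_num), Fin.sum_univ_two, smul_add,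
    smul_smul, smul_smul]
  simp only [one_mul, Fin.val_zero, Fin.val_one, Nat.cast_zero, mul_zero, Nat.cast_one,
    Int.negOnePow_zero, mul_one (Int.negOnePow _)]
  rw [Int.units_mul_self, one_smul, s₀]
  refine (delta_eq_compAt ε hε rfl f).trans ?_
  simp only [e₀, e₁, e₂]
  exact add_sum_add_eq_neg_sub (k := k) (M := Cochain k A B (n + 1)) n _ _ _

/-- The degrees are free variables here so that they can be replaced by casts of natural numbers,
which `m + 1` and `r + 1` do not allow directly. In negative degree `f = 0` and both sides vanish.
-/
theorem deltaZ_eq_sub (ε : B →ₐ[k] A) (hε : ∀ β : B, ε β ∈ Subalgebra.center k A) {M R m : ℤ}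
    (hM : m + 1 = M) (hR : M + 1 = R) (h₁ : M + (1 + 1) = R + 1) (h₂ : (1 + 1) + M = R + 1)
    (f : CochainZ k A B M) :
    deltaZ ε M R hR f =
      -(∑ i ∈ Finset.Icc 0 m, (1 * i).negOnePow • compZ k A B i M (1 + 1) R h₁ f (mulShifted ε) -
        (m * 1).negOnePow • ∑ i ∈ Finset.Icc 0 1, (m * i).negOnePow •
          compZ k A B i (1 + 1) M R h₂ (mulShifted ε) f) := by
  rcases lt_or_ge M 0 with h | h
  · rw [CochainZ.eq_zero h f]
    simp only [map_zero, LinearMap.zero_apply, smul_zero, Finset.sum_const_zero, sub_zero,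
      neg_zero]
  · lift M to ℕ using h
    obtain rfl : R = ((M + 1 : ℕ) : ℤ) := by omega
    exact deltaZ_natCast_eq ε hε M m hM f

/-- The secondary Hochschild differential is the bracket with the multiplication. -/
theorem deltaZ_eq_commBracket (ε : B →ₐ[k] A) (hε : ∀ β : B, ε β ∈ Subalgebra.center k A)
    {m r : ℤ} (h : m + 1 = r) (h' : m + 1 + 1 = r + 1) (f : ShiftedCochain k A B m) :
    deltaZ ε (m + 1) (r + 1) h' f = -commBracket (circ k A B) m 1 r h f (mulShifted ε) := by
  rw [commBracket_apply _ h ((add_comm 1 m).trans h), totalComp_apply, totalComp_apply]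
  exact deltaZ_eq_sub ε hε rfl h' (by omega) (by omega) f

end Multiplication

/-! ### Graded Lie brackets on subquotients -/

section Quotient

universe u

variable {k : Type*} [Field k] {V : ℤ → Type u} [∀ n, AddCommGroup (V n)] [∀ n, Module k (V n)]

/-- The operation induced on the subquotients `Z_m / (W_m ∩ Z_m)`, if `Z` is closed under the
operation and `W` is absorbing for elements of `Z`. -/
def quotientOp (br : GradedOp k V) (Z W : ∀ m, Submodule k (V m))
    (hZ : ∀ m n r h, ∀ f ∈ Z m, ∀ g ∈ Z n, br m n r h f g ∈ Z r)
    (hr : ∀ m n r h, ∀ f ∈ Z m, ∀ g ∈ W n, br m n r h f g ∈ W r)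
    (hl : ∀ m n r h, ∀ f ∈ W m, ∀ g ∈ Z n, br m n r h f g ∈ W r) :
    GradedOp k (fun m => Z m ⧸ (W m).submoduleOf (Z m)) := fun m n r h =>
  let B : Z m →ₗ[k] Z n →ₗ[k] Z r := LinearMap.mk₂ k
    (fun f g => ⟨br m n r h f g, hZ m n r h f f.2 g g.2⟩)
    (fun _ _ _ => Subtype.ext (by simp)) (fun _ _ _ => Subtype.ext (by simp))
    (fun _ _ _ => Subtype.ext (by simp)) (fun _ _ _ => Subtype.ext (by simp))
  ((W m).submoduleOf (Z m)).liftQ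
    (((W n).submoduleOf (Z n)).liftQ (B.compr₂ ((W r).submoduleOf (Z r)).mkQ).flip
      (fun g hg => LinearMap.ext fun f =>
        (Submodule.Quotient.mk_eq_zero _).2 (hr m n r h f f.2 g hg))).flip
    (fun f hf => LinearMap.ext fun y => by
      obtain ⟨g, rfl⟩ := Submodule.Quotient.mk_surjective _ y
      exact (Submodule.Quotient.mk_eq_zero _).2 (hl m n r h f hf g g.2))

variable {br : GradedOp k V} {Z W : ∀ m, Submodule k (V m)}
  (hZ : ∀ m n r h, ∀ f ∈ Z m, ∀ g ∈ Z n, br m n r h f g ∈ Z r)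
  (hr : ∀ m n r h, ∀ f ∈ Z m, ∀ g ∈ W n, br m n r h f g ∈ W r)
  (hl : ∀ m n r h, ∀ f ∈ W m, ∀ g ∈ Z n, br m n r h f g ∈ W r)

theorem quotientOp_mk {m n r : ℤ} (h : m + n = r) (f : Z m) (g : Z n) :
    quotientOp br Z W hZ hr hl m n r h (Submodule.Quotient.mk f) (Submodule.Quotient.mk g) =
      Submodule.Quotient.mk ⟨br m n r h f g, hZ m n r h f f.2 g g.2⟩ := rfl

theorem isGradedLie_quotientOp (H : IsGradedLie br) :
    IsGradedLie (quotientOp br Z W hZ hr hl) where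
  antisymm m n r h h' x y := by
    obtain ⟨f, rfl⟩ := Submodule.Quotient.mk_surjective _ x
    obtain ⟨g, rfl⟩ := Submodule.Quotient.mk_surjective _ y
    rw [quotientOp_mk, quotientOp_mk]
    exact congrArg Submodule.Quotient.mk (Subtype.ext (H.antisymm m n r h h' f g))
  jacobi m n p mn np mp s h₁ h₂ h₃ h₄ h₅ h₆ x y z := by
    obtain ⟨x, rfl⟩ := Submodule.Quotient.mk_surjective _ x
    obtain ⟨y, rfl⟩ := Submodule.Quotient.mk_surjective _ y
    obtain ⟨z, rfl⟩ := Submodule.Quotient.mk_surjective _ z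
    simp only [quotientOp_mk]
    exact congrArg Submodule.Quotient.mk
      (Subtype.ext (H.jacobi m n p mn np mp s h₁ h₂ h₃ h₄ h₅ h₆ x y z))
  self_even m r h x hm := by
    obtain ⟨x, rfl⟩ := Submodule.Quotient.mk_surjective _ x
    rw [quotientOp_mk]
    exact congrArg Submodule.Quotient.mk (Subtype.ext (H.self_even m r h x hm))
  self_odd m r s h h' x hm := by
    obtain ⟨x, rfl⟩ := Submodule.Quotient.mk_surjective _ x
    rw [quotientOp_mk, quotientOp_mk]
    exact congrArg Submodule.Quotient.mk (Subtype.ext (H.self_odd m r s h h' x hm))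

end Quotient

/-! ### Descent of the bracket to cohomology -/

section Cohomology

variable {k A B : Type*} [Field k] [Ring A] [Algebra k A] [CommRing B] [Algebra k B]

variable (k A B) in
theorem isGradedLie_cochain : IsGradedLie (commBracket (circ k A B)) :=
  isGradedLie_commBracket (isPreLieSystem_circ k A B)
    fun _ hn => CochainZ.subsingleton (by omega)

theorem mem_cocycles_iff (ε : B →ₐ[k] A)
    (hε : ∀ β : B, ε β ∈ Subalgebra.center k A) {m r : ℤ} (h : m + 1 = r) (f : ShiftedCochain k A B m) :
    f ∈ cocycles ε (m + 1) ↔ commBracket (circ k A B) m 1 r h f (mulShifted ε) = 0 := by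
  subst h
  rw [cocycles, LinearMap.mem_ker, deltaZ_eq_commBracket ε hε rfl rfl, neg_eq_zero]

theorem commBracket_mem_coboundaries (ε : B →ₐ[k] A)
    (hε : ∀ β : B, ε β ∈ Subalgebra.center k A) {m r : ℤ} (h : m + 1 = r) (u : ShiftedCochain k A B m) :
    commBracket (circ k A B) m 1 r h u (mulShifted ε) ∈ coboundaries ε (r + 1) := by
  have key : ∀ (n' n : ℤ) (hn : n' + 1 = n) (v : CochainZ k A B n'),
      deltaZ ε n' n hn v ∈ coboundaries ε n := by
    intro n' n hn v
    obtain rfl : n' = n - 1 := by omega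
    exact LinearMap.mem_range_self _ v
  have := Submodule.neg_mem _ (key (m + 1) (r + 1) (by omega) u)
  rwa [deltaZ_eq_commBracket ε hε h, neg_neg] at this

theorem exists_of_mem_coboundaries (ε : B →ₐ[k] A)
    (hε : ∀ β : B, ε β ∈ Subalgebra.center k A) {m : ℤ} {f : ShiftedCochain k A B m}
    (hf : f ∈ coboundaries ε (m + 1)) :
    ∃ (l : ℤ) (h : l + 1 = m) (u : ShiftedCochain k A B l),
      commBracket (circ k A B) l 1 m h u (mulShifted ε) = f := by
  have key : ∀ (n' : ℤ) (hn : n' + 1 = m + 1) (v : CochainZ k A B n'),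
      deltaZ ε n' (m + 1) hn v = f → ∃ (l : ℤ) (h : l + 1 = m) (u : ShiftedCochain k A B l),
        commBracket (circ k A B) l 1 m h u (mulShifted ε) = f := by
    intro n' hn v hv
    obtain ⟨l, rfl⟩ : ∃ l, n' = l + 1 := ⟨n' - 1, by omega⟩
    -- The preimage is negated because the differential is minus the bracket with `μ`.
    refine ⟨l, by omega, -v, ?_⟩
    rw [← hv, deltaZ_eq_commBracket ε hε (by omega), map_neg, LinearMap.neg_apply]
  obtain ⟨v, hv⟩ := hf
  exact key _ _ v hv

theorem commBracket_mem_cocycles (ε : B →ₐ[k] A)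
    (hε : ∀ β : B, ε β ∈ Subalgebra.center k A) (m n r : ℤ) (h : m + n = r) (f : ShiftedCochain k A B m)
    (hf : f ∈ cocycles ε (m + 1)) (g : ShiftedCochain k A B n) (hg : g ∈ cocycles ε (n + 1)) :
    commBracket (circ k A B) m n r h f g ∈ cocycles ε (r + 1) := by
  rw [mem_cocycles_iff ε hε rfl] at hf hg ⊢
  -- Jacobi for `f, g, μ` expresses `[[f, g], μ]` through `[f, [g, μ]]` and `[g, [f, μ]]`, both
  -- zero.
  have := (isGradedLie_cochain k A B).jacobi m n 1 r (n + 1) (m + 1) (r + 1) rfl (by omega) h rfl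
    rfl (by omega) f g (mulShifted ε)
  rw [hf, hg, map_zero, map_zero, smul_zero, add_zero] at this
  exact this.symm

theorem commBracket_mem_coboundaries_right (ε : B →ₐ[k] A)
    (hε : ∀ β : B, ε β ∈ Subalgebra.center k A) (m n r : ℤ) (h : m + n = r)
    (f : ShiftedCochain k A B m) (hf : f ∈ cocycles ε (m + 1)) (g : ShiftedCochain k A B n)
    (hg : g ∈ coboundaries ε (n + 1)) :
    commBracket (circ k A B) m n r h f g ∈ coboundaries ε (r + 1) := by
  obtain ⟨l, hl, u, rfl⟩ := exists_of_mem_coboundaries ε hε hg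
  rw [mem_cocycles_iff ε hε rfl] at hf
  -- With `[f, μ] = 0`, Jacobi for `f, u, μ` gives the explicit primitive `[f, u]`, up to sign, of
  -- `[f, [u, μ]]`.
  rw [(isGradedLie_cochain k A B).jacobi m l 1 (m + l) n (m + 1) r hl h rfl (by omega)
    rfl (by omega) f u (mulShifted ε), hf, map_zero, smul_zero, add_zero]
  exact commBracket_mem_coboundaries ε hε _ _

theorem commBracket_mem_coboundaries_left (ε : B →ₐ[k] A)
    (hε : ∀ β : B, ε β ∈ Subalgebra.center k A) (m n r : ℤ) (h : m + n = r)
    (f : ShiftedCochain k A B m) (hf : f ∈ coboundaries ε (m + 1)) (g : ShiftedCochain k A B n)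
    (hg : g ∈ cocycles ε (n + 1)) :
    commBracket (circ k A B) m n r h f g ∈ coboundaries ε (r + 1) := by
  rw [(isGradedLie_cochain k A B).antisymm m n r h (by omega), Units.smul_def]
  exact Submodule.neg_mem _ (zsmul_mem
    (commBracket_mem_coboundaries_right ε hε n m r (by omega) g hg f hf) _)

end Cohomology

end SecHoch

theorem mainTheorem2 {k A B : Type*} [Field k] [Ring A] [Algebra k A] [CommRing B] [Algebra k B]
    (ε : B →ₐ[k] A) (hε : ∀ β : B, ε β ∈ Subalgebra.center k A) :
    SecHoch.IsPreLieSystem k (SecHoch.ShiftedCochain k A B) (SecHoch.circ k A B) ∧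
    ∃! br : SecHoch.GradedOp k (SecHoch.ShiftedCohomology ε),
      (∀ (m n r : ℤ) (h : m + n = r)
        (f : SecHoch.ShiftedCochain k A B m) (hf : f ∈ SecHoch.cocycles ε (m + 1))
        (g : SecHoch.ShiftedCochain k A B n) (hg : g ∈ SecHoch.cocycles ε (n + 1)),
        ∃ hfg : SecHoch.commBracket (SecHoch.circ k A B) m n r h f g ∈
            SecHoch.cocycles ε (r + 1),
          br m n r h (SecHoch.cls ε (m + 1) f hf) (SecHoch.cls ε (n + 1) g hg) =
            SecHoch.cls ε (r + 1)
              (SecHoch.commBracket (SecHoch.circ k A B) m n r h f g) hfg) ∧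
      SecHoch.IsGradedLie br := by
  have hZ := SecHoch.commBracket_mem_cocycles ε hε
  refine ⟨SecHoch.isPreLieSystem_circ k A B,
    SecHoch.quotientOp (V := SecHoch.ShiftedCochain k A B) (SecHoch.commBracket (SecHoch.circ k A B))
      (fun m => SecHoch.cocycles ε (m + 1)) (fun m => SecHoch.coboundaries ε (m + 1)) hZ
      (SecHoch.commBracket_mem_coboundaries_right ε hε)
      (SecHoch.commBracket_mem_coboundaries_left ε hε),
    ⟨fun m n r h f hf g hg => ⟨hZ m n r h f hf g hg, rfl⟩,
      SecHoch.isGradedLie_quotientOp _ _ _ (SecHoch.isGradedLie_cochain k A B)⟩, ?_⟩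
  -- Uniqueness: every class has a cocycle representative, so the values on classes of cocycles
  -- determine the operation.
  rintro br ⟨hbr, -⟩
  funext m n r h
  refine LinearMap.ext fun x => LinearMap.ext fun y => ?_
  obtain ⟨f, rfl⟩ := Submodule.Quotient.mk_surjective _ x
  obtain ⟨g, rfl⟩ := Submodule.Quotient.mk_surjective _ y
  obtain ⟨_, e⟩ := hbr m n r h f f.2 g g.2
  exact e
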